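/- Let $\mathfrak h$ be a complex Hilbert space with an antiunitary involution $\Gamma$, let $\mathfrak p\subseteq\mathfrak h$ be a closed subspace whose orthogonal projection $P$ is a basis projection, i.e. $P+\Gamma P\Gamma=\mathbb 1$, and let $\mathfrak q\subseteq\mathfrak h$ be a closed $\Gamma$-invariant subspace with orthogonal projection $Q$. Write $P^\perp=\mathbb 1-P$, $Q^\perp=\mathbb 1-Q$. Assume that $\mathfrak p\cap\mathfrak q=\{0\}=\mathfrak p\cap\mathfrak q^\perp$ (then $\mathfrak p$ and $\mathfrak q$ are in generic position). Let $\alpha,\beta$ be the densely defined antilinear operators on $\mathfrak p$ with graphs $$\mathrm{gra}\,\beta=\{(Pq,P\Gamma q)\mid q\in\mathfrak q\},\qquad \mathrm{gra}\,\alpha=\{(Pq^\perp,-P\Gamma q^\perp)\mid q^\perp\in\mathfrak q^\perp\},$$ where the adjoint of an antilinear operator $T$ is given by $\langle T^*x,y\rangle=\langle Ty,x\rangle$. (Inner products are antilinear in the first argument.) Let $\mathfrak F=\bigoplus_{n\ge0}\bigwedge^n\mathfrak p$ be the antisymmetric Fock space over $\mathfrak p$ with vacuum $\Omega$ and annihilation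 and creation operators $c(p),c(p)^*$, let $a(f)=c(P\Gamma f)^*+c(Pf)$ for $f\in\mathfrak h$, and let $\mathcal M(\mathfrak q)=\{a(q)\mid q\in\mathfrak q\}''$ be the von Neumann algebra generated on $\mathfrak F$. Let $S$ be the Tomita operator of $(\mathcal M(\mathfrak q),\Omega)$, i.e. the closure of $M\Omega\mapsto M^*\Omega$, $M\in\mathcal M(\mathfrak q)$. Then $\Delta_{\mathfrak p}:=\beta^*\beta$ is a densely defined, linear, positive, self-adjoint operator on $\mathfrak p$ with graph $$\mathrm{gra}\,\Delta_{\mathfrak p}=\{(PQp,\,PQ^\perp p)\mid p\in\mathfrak p\}.$$ Moreover, $\Delta_{\mathfrak p}$ is injective and $\Delta_{\mathfrak p}^{-1}=\beta\beta^*=\alpha^*\alpha$. Finally, $\Delta_{\mathfrak p}$ has a unique positive self-adjoint square root $\Delta_{\mathfrak p}^{1/2}$, there is a unique pair consisting of a positive self-adjoint operator $\Delta$ (the modular operator) and an antiunitary operator $J$ (the modular conjugation) on $\mathfrak F$ with $S=J\Delta^{1/2}$, and for every $q\in\mathfrak q$ one has $P\Gamma q\in\mathrm{dom}\,\Delta_{\mathfrak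 p}^{1/2}$ and $$J(Pq)=\Delta_{\mathfrak p}^{1/2}(P\Gamma q),$$ where $\mathfrak p$ is identified with the one-particle subspace of $\mathfrak F$. -/

import Mathlib

open scoped InnerProductSpace

noncomputable section

/-! ### Antisymmetric Fock space -/

namespace Fock

section Pre

variable {K : Type*} [NormedAddCommGroup K] [InnerProductSpace ℂ K]

/-- Contraction of antisymmetric tensors by `v`:
`v₁ ∧ ⋯ ∧ vₙ ↦ ∑ r, (-1) ^ (r - 1) * ⟪v, vᵣ⟫ • v₁ ∧ ⋯ v̂ᵣ ⋯ ∧ vₙ`. -/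
def contract (v : K) : ExteriorAlgebra ℂ K →ₗ[ℂ] ExteriorAlgebra ℂ K :=
  CliffordAlgebra.contractLeft (innerₛₗ ℂ v)

/-- Exterior multiplication by `v` from the left:
`v₁ ∧ ⋯ ∧ vₙ ↦ v ∧ v₁ ∧ ⋯ ∧ vₙ`. -/
def wedgeLeft (v : K) : ExteriorAlgebra ℂ K →ₗ[ℂ] ExteriorAlgebra ℂ K :=
  LinearMap.mulLeft ℂ (ExteriorAlgebra.ι ℂ v)

lemma contract_ι_mul (v w : K) (x : ExteriorAlgebra ℂ K) :
    contract v (ExteriorAlgebra.ι ℂ w * x)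
      = ⟪v, w⟫_ℂ • x - ExteriorAlgebra.ι ℂ w * contract v x :=
  CliffordAlgebra.contractLeft_ι_mul _ _ _

lemma contract_contract (v : K) (x : ExteriorAlgebra ℂ K) : contract v (contract v x) = 0 :=
  CliffordAlgebra.contractLeft_contractLeft _ _

lemma contract_algebraMap (v : K) (r : ℂ) :
    contract v (algebraMap ℂ (ExteriorAlgebra ℂ K) r) = 0 :=
  CliffordAlgebra.contractLeft_algebraMap _ _ _

/-- Precomposition with the contraction by `v`, on antilinear functionals. -/
def precontract : K →ₗ[ℂ] Module.End ℂ (ExteriorAlgebra ℂ K →ₗ⋆[ℂ] ℂ) where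
  toFun v :=
    { toFun := fun φ => φ.comp (contract v)
      map_add' := fun _ _ => rfl
      map_smul' := fun _ _ => rfl }
  map_add' v w := by
    ext φ x
    simp [contract, map_add]
  map_smul' c v := by
    ext φ x
    simp [contract, map_smulₛₗ]

/-- The sesquilinear form `⟪x, y⟫ = innerForm y x` on the exterior algebra for which
`⟪1, 1⟫ = 1`, scalars are orthogonal to every positive degree, and left exterior multiplication
by `v` is adjoint to the contraction by `v`. On wedge products of the same length it is
`⟪v₁ ∧ ⋯ ∧ vₙ, w₁ ∧ ⋯ ∧ wₙ⟫ = det ⟪vᵢ, wⱼ⟫`. -/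
def innerForm : ExteriorAlgebra ℂ K →ₗ[ℂ] ExteriorAlgebra ℂ K →ₗ⋆[ℂ] ℂ :=
  (LinearMap.applyₗ
    ((starLinearEquiv ℂ (A := ℂ)).toLinearMap.comp
      (ExteriorAlgebra.algebraMapInv (R := ℂ) (M := K)).toLinearMap)).comp
  (ExteriorAlgebra.lift ℂ ⟨precontract (K := K), fun v => by
    ext φ x
    simp [precontract, contract_contract]⟩).toLinearMap

lemma innerForm_algebraMap (r : ℂ) (x : ExteriorAlgebra ℂ K) :
    innerForm (algebraMap ℂ _ r) x = r * star (ExteriorAlgebra.algebraMapInv x) := by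
  simp [innerForm, Algebra.algebraMap_eq_smul_one]

lemma innerForm_ι_mul (v : K) (y x : ExteriorAlgebra ℂ K) :
    innerForm (ExteriorAlgebra.ι ℂ v * y) x = innerForm y (contract v x) := by
  simp [innerForm, precontract]

lemma algebraMapInv_ι_mul (v : K) (x : ExteriorAlgebra ℂ K) :
    ExteriorAlgebra.algebraMapInv (ExteriorAlgebra.ι ℂ v * x) = (0 : ℂ) := by
  simp [ExteriorAlgebra.algebraMapInv]

lemma innerForm_contract (v : K) (x y : ExteriorAlgebra ℂ K) :
    innerForm y (ExteriorAlgebra.ι ℂ v * x) = innerForm (contract v y) x := by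
  induction y using CliffordAlgebra.left_induction generalizing x with
  | algebraMap r =>
    rw [innerForm_algebraMap, contract_algebraMap, algebraMapInv_ι_mul]
    simp
  | add a b ha hb => simp [ha, hb]
  | ι_mul y w ih =>
    have h1 := innerForm_ι_mul w y (ExteriorAlgebra.ι ℂ v * x)
    have h2 := contract_ι_mul v w y
    rw [show CliffordAlgebra.ι (0 : QuadraticForm ℂ K) w = ExteriorAlgebra.ι ℂ w from rfl,
      h1, h2, contract_ι_mul]
    simp only [map_sub, map_smulₛₗ, LinearMap.sub_apply, LinearMap.smul_apply, ih,
      innerForm_ι_mul, smul_eq_mul, inner_conj_symm, RingHom.id_apply]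

lemma innerForm_symm (x y : ExteriorAlgebra ℂ K) :
    star (innerForm y x) = innerForm x y := by
  induction y using CliffordAlgebra.left_induction generalizing x with
  | algebraMap r =>
    rw [innerForm_algebraMap]
    induction x using CliffordAlgebra.left_induction with
    | algebraMap s =>
      rw [innerForm_algebraMap]
      simp [mul_comm]
    | add a b ha hb =>
      simp only [map_add, star_add, mul_add, LinearMap.add_apply] at ha hb ⊢
      rw [ha, hb]
    | ι_mul x w ih =>
      rw [show CliffordAlgebra.ι (0 : QuadraticForm ℂ K) w = ExteriorAlgebra.ι ℂ w from rfl,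
        innerForm_ι_mul, algebraMapInv_ι_mul, contract_algebraMap]
      simp
  | add a b ha hb => simp only [map_add, LinearMap.add_apply, star_add, ha, hb]
  | ι_mul y w ih =>
    rw [show CliffordAlgebra.ι (0 : QuadraticForm ℂ K) w = ExteriorAlgebra.ι ℂ w from rfl,
      innerForm_ι_mul, ih, innerForm_contract]

/-- The span of the products of elements of a list, in the order of the list. -/
def listSpan : List K → Submodule ℂ (ExteriorAlgebra ℂ K)
  | [] => Submodule.span ℂ {1}
  | b :: l => listSpan l ⊔ (listSpan l).map (wedgeLeft b)

lemma mem_listSpan_cons {b : K} {l : List K} {x : ExteriorAlgebra ℂ K} :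
    x ∈ listSpan (b :: l) ↔ ∃ y ∈ listSpan l, ∃ z ∈ listSpan l,
      y + ExteriorAlgebra.ι ℂ b * z = x := by
  simp [listSpan, Submodule.mem_sup, wedgeLeft]

lemma algebraMap_mem_listSpan (r : ℂ) (l : List K) : algebraMap ℂ _ r ∈ listSpan l := by
  induction l with
  | nil => exact Submodule.mem_span_singleton.2 ⟨r, (Algebra.algebraMap_eq_smul_one r).symm⟩
  | cons b l ih => exact Submodule.mem_sup_left ih

lemma ι_mul_mem_listSpan {b : K} {l : List K} (hb : b ∈ l) {x : ExteriorAlgebra ℂ K}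
    (hx : x ∈ listSpan l) : ExteriorAlgebra.ι ℂ b * x ∈ listSpan l := by
  induction l generalizing x with
  | nil => simp at hb
  | cons c l ih =>
    obtain ⟨y, hy, z, hz, rfl⟩ := mem_listSpan_cons.1 hx
    rw [mem_listSpan_cons]
    rcases List.mem_cons.1 hb with rfl | hb
    · refine ⟨0, zero_mem _, y, hy, ?_⟩
      rw [mul_add, ← mul_assoc, ExteriorAlgebra.ι_sq_zero, zero_mul, add_zero, zero_add]
    · refine ⟨_, ih hb hy, -(ExteriorAlgebra.ι ℂ b * z), neg_mem (ih hb hz), ?_⟩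
      have h : ExteriorAlgebra.ι ℂ b * ExteriorAlgebra.ι ℂ c
          = -(ExteriorAlgebra.ι ℂ c * ExteriorAlgebra.ι ℂ b) :=
        eq_neg_of_add_eq_zero_left (ExteriorAlgebra.ι_add_mul_swap b c)
      rw [mul_add, ← mul_assoc (ExteriorAlgebra.ι ℂ b), h, mul_neg, neg_mul, mul_assoc]

lemma span_mul_mem_listSpan {v : K} {l : List K} (hv : v ∈ Submodule.span ℂ {b | b ∈ l})
    {x : ExteriorAlgebra ℂ K} (hx : x ∈ listSpan l) :
    ExteriorAlgebra.ι ℂ v * x ∈ listSpan l := by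
  induction hv using Submodule.span_induction with
  | mem b hb => exact ι_mul_mem_listSpan hb hx
  | zero => simp
  | add a b _ _ ha hb =>
    rw [map_add, add_mul]
    exact add_mem ha hb
  | smul c a _ ha =>
    rw [map_smul, smul_mul_assoc]
    exact Submodule.smul_mem _ _ ha

lemma contract_listSpan {b : K} {l : List K} (h : ∀ c ∈ l, ⟪b, c⟫_ℂ = 0)
    {x : ExteriorAlgebra ℂ K} (hx : x ∈ listSpan l) : contract b x = 0 := by
  induction l generalizing x with
  | nil =>
    obtain ⟨r, rfl⟩ := Submodule.mem_span_singleton.1 hx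
    rw [← Algebra.algebraMap_eq_smul_one, contract_algebraMap]
  | cons c l ih =>
    obtain ⟨y, hy, z, hz, rfl⟩ := mem_listSpan_cons.1 hx
    have h' : ∀ c ∈ l, ⟪b, c⟫_ℂ = 0 := fun c hc => h c (List.mem_cons_of_mem _ hc)
    rw [map_add, contract_ι_mul, ih h' hy, ih h' hz, h c List.mem_cons_self]
    simp

lemma innerForm_listSpan {l : List K} (hl : l.Pairwise fun b c => ⟪b, c⟫_ℂ = 0)
    (h1 : ∀ b ∈ l, ‖b‖ = 1) {x : ExteriorAlgebra ℂ K} (hx : x ∈ listSpan l) :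
    0 ≤ (innerForm x x).re ∧ ((innerForm x x).re = 0 → x = 0) := by
  induction l generalizing x with
  | nil =>
    obtain ⟨r, rfl⟩ := Submodule.mem_span_singleton.1 hx
    rw [← Algebra.algebraMap_eq_smul_one, innerForm_algebraMap]
    have : (r * star (ExteriorAlgebra.algebraMapInv (algebraMap ℂ (ExteriorAlgebra ℂ K) r))).re
        = Complex.normSq r := by
      simp [Complex.normSq_apply]
    rw [this]
    refine ⟨Complex.normSq_nonneg r, fun h => ?_⟩
    rw [Complex.normSq_eq_zero.1 h, map_zero]
  | cons b l ih =>
    obtain ⟨y, hy, z, hz, rfl⟩ := mem_listSpan_cons.1 hx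
    rw [List.pairwise_cons] at hl
    have h1' : ∀ b ∈ l, ‖b‖ = 1 := fun c hc => h1 c (List.mem_cons_of_mem _ hc)
    have hbb : ⟪b, b⟫_ℂ = 1 := by
      rw [inner_self_eq_norm_sq_to_K, h1 b List.mem_cons_self]
      simp
    have key : innerForm (y + ExteriorAlgebra.ι ℂ b * z) (y + ExteriorAlgebra.ι ℂ b * z)
        = innerForm y y + innerForm z z := by
      simp only [map_add, LinearMap.add_apply, innerForm_ι_mul, innerForm_contract,
        contract_ι_mul, contract_listSpan hl.1 hy, contract_listSpan hl.1 hz, hbb]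
      simp
    obtain ⟨hy0, hy1⟩ := ih hl.2 h1' hy
    obtain ⟨hz0, hz1⟩ := ih hl.2 h1' hz
    rw [key, Complex.add_re]
    refine ⟨add_nonneg hy0 hz0, fun h => ?_⟩
    rw [hy1 (by linarith), hz1 (by linarith), mul_zero, add_zero]

lemma exists_listSpan (x : ExteriorAlgebra ℂ K) :
    ∃ W : Submodule ℂ K, FiniteDimensional ℂ W ∧
      ∀ l : List K, W ≤ Submodule.span ℂ {b | b ∈ l} → x ∈ listSpan l := by
  induction x using CliffordAlgebra.left_induction with
  | algebraMap r => exact ⟨⊥, inferInstance, fun l _ => algebraMap_mem_listSpan r l⟩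
  | add x y hx hy =>
    obtain ⟨V, hV, hx⟩ := hx
    obtain ⟨W, hW, hy⟩ := hy
    exact ⟨V ⊔ W, inferInstance, fun l hl =>
      add_mem (hx l (le_sup_left.trans hl)) (hy l (le_sup_right.trans hl))⟩
  | ι_mul x v hx =>
    obtain ⟨V, hV, hx⟩ := hx
    exact ⟨V ⊔ Submodule.span ℂ {v}, inferInstance, fun l hl => span_mul_mem_listSpan
      (hl (Submodule.mem_sup_right (Submodule.mem_span_singleton_self v)))
      (hx l (le_sup_left.trans hl))⟩

lemma innerForm_self (x : ExteriorAlgebra ℂ K) :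
    0 ≤ (innerForm x x).re ∧ ((innerForm x x).re = 0 → x = 0) := by
  obtain ⟨W, hW, h⟩ := exists_listSpan x
  let b := stdOrthonormalBasis ℂ W
  refine innerForm_listSpan (l := List.ofFn fun i => (b i : K)) ?_ ?_ (h _ ?_)
  · rw [List.pairwise_ofFn]
    intro i j hij
    exact b.orthonormal.2 hij.ne
  · simp only [List.mem_ofFn, forall_exists_index]
    rintro _ i rfl
    exact b.orthonormal.1 i
  · intro w hw
    have := b.toBasis.mem_span ⟨w, hw⟩
    have h2 := Submodule.mem_map_of_mem (f := W.subtype) this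
    rw [Submodule.map_span] at h2
    refine Submodule.span_mono ?_ h2
    rintro _ ⟨_, ⟨i, rfl⟩, rfl⟩
    simp

/-- The inner product of the algebraic antisymmetric Fock space. -/
@[reducible]
def innerCore : InnerProductSpace.Core ℂ (ExteriorAlgebra ℂ K) where
  inner x y := innerForm y x
  conj_inner_symm x y := innerForm_symm y x
  re_inner_nonneg x := (innerForm_self x).1
  add_left x y z := map_add _ x y
  smul_left x y r := by simp
  definite x hx := (innerForm_self x).2 (by rw [hx]; rfl)

instance instNormedAddCommGroupExteriorAlgebra : NormedAddCommGroup (ExteriorAlgebra ℂ K) :=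
  (innerCore (K := K)).toNormedAddCommGroup

instance instInnerProductSpaceExteriorAlgebra : InnerProductSpace ℂ (ExteriorAlgebra ℂ K) :=
  InnerProductSpace.ofCore (innerCore (K := K)).toCore

lemma inner_eq_innerForm (x y : ExteriorAlgebra ℂ K) : ⟪x, y⟫_ℂ = innerForm y x := rfl

lemma inner_wedgeLeft (v : K) (x y : ExteriorAlgebra ℂ K) :
    ⟪wedgeLeft v x, y⟫_ℂ = ⟪x, contract v y⟫_ℂ :=
  innerForm_contract v x y

lemma norm_sq_wedgeLeft_add (v : K) (x : ExteriorAlgebra ℂ K) :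
    ‖wedgeLeft v x‖ ^ 2 + ‖contract v x‖ ^ 2 = ‖v‖ ^ 2 * ‖x‖ ^ 2 := by
  have a : ⟪wedgeLeft v (contract v x), x⟫_ℂ = ⟪contract v x, contract v x⟫_ℂ :=
    inner_wedgeLeft v _ x
  have b : ⟪x, wedgeLeft v (contract v x)⟫_ℂ = ⟪contract v x, contract v x⟫_ℂ := by
    rw [← inner_conj_symm, a, inner_conj_symm]
  have c : contract v (wedgeLeft v x) = ⟪v, v⟫_ℂ • x - wedgeLeft v (contract v x) :=
    contract_ι_mul v v x
  have d : ⟪wedgeLeft v x, wedgeLeft v x⟫_ℂ + ⟪contract v x, contract v x⟫_ℂ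
      = ⟪v, v⟫_ℂ * ⟪x, x⟫_ℂ := by
    rw [inner_wedgeLeft, c, inner_sub_right, inner_smul_right, b, sub_add_cancel]
  simp only [inner_self_eq_norm_sq_to_K] at d
  exact_mod_cast d

lemma norm_wedgeLeft_le (v : K) (x : ExteriorAlgebra ℂ K) : ‖wedgeLeft v x‖ ≤ ‖v‖ * ‖x‖ := by
  refine le_of_sq_le_sq ?_ (by positivity)
  nlinarith [norm_sq_wedgeLeft_add v x, sq_nonneg ‖contract v x‖]

lemma norm_contract_le (v : K) (x : ExteriorAlgebra ℂ K) : ‖contract v x‖ ≤ ‖v‖ * ‖x‖ := by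
  refine le_of_sq_le_sq ?_ (by positivity)
  nlinarith [norm_sq_wedgeLeft_add v x, sq_nonneg ‖wedgeLeft v x‖]

end Pre

open UniformSpace (Completion)

/-- The antisymmetric Fock space over `K`: the Hilbert space completion of the exterior
algebra `⨁ₙ ⋀ⁿ K`. -/
abbrev FockSpace (K : Type*) [NormedAddCommGroup K] [InnerProductSpace ℂ K] : Type _ :=
  Completion (ExteriorAlgebra ℂ K)

section Operators

variable {K : Type*} [NormedAddCommGroup K] [InnerProductSpace ℂ K]

/-- The Fock vacuum. -/
def vacuum (K : Type*) [NormedAddCommGroup K] [InnerProductSpace ℂ K] : FockSpace K :=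
  ((1 : ExteriorAlgebra ℂ K) : Completion (ExteriorAlgebra ℂ K))

/-- The inclusion of the one-particle space into the Fock space. -/
def oneParticle (v : K) : FockSpace K :=
  ((ExteriorAlgebra.ι ℂ v : ExteriorAlgebra ℂ K) : Completion (ExteriorAlgebra ℂ K))

/-- The extension to the completion of a bounded operator. -/
def extendCLM {E : Type*} [NormedAddCommGroup E] [NormedSpace ℂ E] (T : E →L[ℂ] E) :
    Completion E →L[ℂ] Completion E :=
  (Completion.toComplL.comp T).extend (Completion.toComplL (𝕜 := ℂ) (E := E))

lemma extendCLM_coe {E : Type*} [NormedAddCommGroup E] [NormedSpace ℂ E] (T : E →L[ℂ] E)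
    (x : E) : extendCLM T (x : Completion E) = (T x : Completion E) :=
  ContinuousLinearMap.extend_eq _ (Completion.denseRange_coe)
    (Completion.isUniformInducing_coe E) x

/-- The creation operator `c(v)^*`. -/
def creation (v : K) : FockSpace K →L[ℂ] FockSpace K :=
  extendCLM ((wedgeLeft v).mkContinuous ‖v‖ (norm_wedgeLeft_le v))

/-- The annihilation operator `c(v)`. -/
def annihilation (v : K) : FockSpace K →L[ℂ] FockSpace K :=
  extendCLM ((contract v).mkContinuous ‖v‖ (norm_contract_le v))

lemma star_creation (v : K) : star (creation v) = annihilation v := by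
  rw [ContinuousLinearMap.star_eq_adjoint, eq_comm, ContinuousLinearMap.eq_adjoint_iff]
  intro x y
  induction x, y using Completion.induction_on₂ with
  | hp => exact isClosed_eq (by fun_prop) (by fun_prop)
  | ih x y =>
    rw [annihilation, creation, extendCLM_coe, extendCLM_coe, Completion.inner_coe,
      Completion.inner_coe, ← inner_conj_symm, ← inner_conj_symm x]
    exact congrArg _ (inner_wedgeLeft v y x).symm

lemma star_annihilation (v : K) : star (annihilation v) = creation v := by
  rw [← star_creation, star_star]

end Operators

end Fock

/-! ### The self-dual CAR-algebra in the Fock representation -/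

namespace CAR

open Fock

variable {H : Type*} [NormedAddCommGroup H] [InnerProductSpace ℂ H]

/-- The orthogonal projection `P` onto `p` is a basis projection: `P + Γ P Γ = 1`. -/
def IsBasisProjection (Γ : H ≃ₗᵢ⋆[ℂ] H) (p : Submodule ℂ H) [p.HasOrthogonalProjection] : Prop :=
  ∀ x : H, p.starProjection x + Γ (p.starProjection (Γ x)) = x

/-- The generator `a(f) = c(P Γ f)^* + c(P f)` of the CAR-algebra in the Fock representation
given by the basis projection `P` onto `p`. -/
def generator (Γ : H ≃ₗᵢ⋆[ℂ] H) (p : Submodule ℂ H) [p.HasOrthogonalProjection] (f : H) :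
    FockSpace p →L[ℂ] FockSpace p :=
  creation (p.orthogonalProjectionOnto (Γ f)) + annihilation (p.orthogonalProjectionOnto f)

lemma star_generator {Γ : H ≃ₗᵢ⋆[ℂ] H} (hΓ : ∀ x, Γ (Γ x) = x) (p : Submodule ℂ H)
    [p.HasOrthogonalProjection] (f : H) : star (generator Γ p f) = generator Γ p (Γ f) := by
  rw [generator, generator, star_add, star_creation, star_annihilation, hΓ, add_comm]

/-- The von Neumann algebra `{a(f) | f ∈ q}''` on the Fock space over `p`, for a
`Γ`-invariant subspace `q`. -/
def localAlgebra {Γ : H ≃ₗᵢ⋆[ℂ] H} (hΓ : ∀ x, Γ (Γ x) = x) (p : Submodule ℂ H)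
    [p.HasOrthogonalProjection] {q : Submodule ℂ H} (hq : ∀ x ∈ q, Γ x ∈ q) :
    VonNeumannAlgebra (FockSpace p) where
  toSubalgebra := Subalgebra.centralizer ℂ (Set.centralizer (generator Γ p '' q))
  star_mem' := by
    have h : ∀ T ∈ Set.centralizer (generator Γ p '' q),
        star T ∈ Set.centralizer (generator Γ p '' q) := by
      intro T hT
      rw [Set.mem_centralizer_iff] at hT ⊢
      rintro _ ⟨f, hf, rfl⟩
      have := congrArg star (hT _ ⟨Γ f, hq f hf, rfl⟩)
      rw [star_mul, star_mul, star_generator hΓ, hΓ] at this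
      exact this.symm
    intro A hA T hT
    have := congrArg star (hA _ (h T hT))
    rw [star_mul, star_mul, star_star] at this
    exact this.symm
  centralizer_centralizer' := by
    exact Set.centralizer_centralizer_centralizer _

/-- The antilinear operator `β` with graph `{(P x, P Γ x) | x ∈ q}`. -/
def beta (Γ : H ≃ₗᵢ⋆[ℂ] H) (p : Submodule ℂ H) [p.HasOrthogonalProjection]
    (q : Submodule ℂ H) : SetRel p p :=
  {z | ∃ x ∈ q, z = (p.orthogonalProjectionOnto x, p.orthogonalProjectionOnto (Γ x))}

/-- The antilinear operator `α` with graph `{(P x, -P Γ x) | x ∈ qᗮ}`. -/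
def alpha (Γ : H ≃ₗᵢ⋆[ℂ] H) (p : Submodule ℂ H) [p.HasOrthogonalProjection]
    (q : Submodule ℂ H) : SetRel p p :=
  {z | ∃ x ∈ qᗮ, z = (p.orthogonalProjectionOnto x, -p.orthogonalProjectionOnto (Γ x))}

end CAR

/-! ### Unbounded operators and modular theory

Antilinear unbounded operators are given by their graphs. -/

namespace Modular

variable {E : Type*} [NormedAddCommGroup E] [InnerProductSpace ℂ E]

/-- The product `S T` of unbounded operators given by their graphs: first `T`, then `S`. -/
def opMul (S T : SetRel E E) : SetRel E E := T.comp S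

/-- The adjoint of an antilinear operator `T` given by its graph:
`(x, z)` is in the graph of `T^*` iff `⟪z, y⟫ = ⟪T y, x⟫` for all `y` in the domain of `T`. -/
def antilinearAdjoint (T : SetRel E E) : SetRel E E :=
  {xz | ∀ y w : E, (y, w) ∈ T → ⟪xz.2, y⟫_ℂ = ⟪w, xz.1⟫_ℂ}

/-- The graph of a linear operator, as a relation. -/
def graphRel (T : E →ₗ.[ℂ] E) : SetRel E E := (T.graph : Set (E × E))

/-- Densely defined, positive and self-adjoint operators. -/
structure IsPositiveSelfAdjoint [CompleteSpace E] (T : E →ₗ.[ℂ] E) : Prop where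
  dense_domain : Dense (T.domain : Set E)
  isSelfAdjoint : IsSelfAdjoint T
  nonneg : ∀ x : T.domain, 0 ≤ (⟪(x : E), T x⟫_ℂ).re

/-- `R` is the positive self-adjoint square root `T^{1/2}`. -/
structure IsPositiveSqrt [CompleteSpace E] (T R : E →ₗ.[ℂ] E) : Prop where
  isPositiveSelfAdjoint : IsPositiveSelfAdjoint R
  mul_self : opMul (graphRel R) (graphRel R) = graphRel T

/-- The graph of the Tomita operator `S` of `(M, Ω)`: the closure of the graph of
`A Ω ↦ A^* Ω`, `A ∈ M`. -/
def tomita [CompleteSpace E] (M : VonNeumannAlgebra E) (Ω : E) : SetRel E E :=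
  closure {z : E × E | ∃ A ∈ M, z = (A Ω, star A Ω)}

/-- `Δ` and `J` are the modular operator and the modular conjugation of `(M, Ω)`:
`S = J Δ^{1/2}` with `Δ` positive and self-adjoint and `J` antiunitary. -/
def IsModularPair [CompleteSpace E] (M : VonNeumannAlgebra E) (Ω : E)
    (Δ : E →ₗ.[ℂ] E) (J : E ≃ₗᵢ⋆[ℂ] E) : Prop :=
  IsPositiveSelfAdjoint Δ ∧ ∃ R : E →ₗ.[ℂ] E, IsPositiveSqrt Δ R ∧
    tomita M Ω = {z : E × E | ∃ x : R.domain, z = ((x : E), J (R x))}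

end Modular

end

/-!
The proof works with resolvents instead of unbounded operators. Let `T` be a closed, densely
defined antilinear operator with `T = T⁻¹`. The orthogonal projection of `(z, 0)` onto the graph
of `T` has first component `A z`, where `A = (1 + T^* T)⁻¹` is bounded with `0 ≤ A ≤ 1`
(`IsAntilinearInvolution.exists_isResolvent`). In terms of `A`,

* `T^* T` has the graph `{(A z, z - A z)}` (`IsResolvent.mem_opMul_adjoint`), and its positive
  square root has the graph `{(A^{1/2} z, (1 - A)^{1/2} z)}`; both are self-adjoint since no pair
  outside such a graph is compatible with it (`IsGraphPair.isPositiveSelfAdjoint`);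
* if `R` is any positive square root of `T^* T`, then `R A` is the positive square root of
  `A (1 - A)`, which together with `A` determines `R`
  (`IsContractiveResolvent.eq_sqrtOfResolvent`);
* `T = J (T^* T)^{1/2}` for an antiunitary involution `J` (`IsResolvent.exists_polar`), and every
  polar decomposition of `T` has this positive part (`IsResolvent.eq_ofResolvent`).

This applies to `β`, whose resolvent is the compression `P Q P` (`isResolvent_beta`), to `α`, whose
resolvent is `P Q^⊥ P = 1 - P Q P`, and, because `β^* = α` and `α^* = β`, it yields all the
identities for `Δ_𝔭`.

It also applies to the Tomita operator `S`. The vacuum is cyclic for `M(𝔮)`, because `P 𝔮` is dense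
in `𝔭` and `a(f)` acts as the creation operator `c(P Γ f)^*` up to terms with fewer particles
(`eq_top_of_creation_add_annihilation_mem`). It is separating, because the operators
`a(f) (-1)^N` with `f ∈ 𝔮^⊥` lie in the commutant and the vacuum is cyclic for them by the same
argument.

No explicit form of `S` on the whole Fock space is needed: on one-particle vectors `S` extends `β`,
while the adjoint of `S` extends `α`, by means of `a(f) (-1)^N`. Hence the one-particle
component of `S x` is `α^* = β` applied to that of `x` (`adjoint_oneParticle_mem_beta`), so the
one-particle space reduces `S` to `β`, the resolvent of `S` to `P Q P` (`resolvent_oneParticle`)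
and `Δ^{1/2}` to `Δ_𝔭^{1/2}` (`map_mem_graph_sqrtOfResolvent`). Now `P q = S (P Γ q)
= J Δ_𝔭^{1/2} (P Γ q)`, and `J² = 1` gives the formula for `J (P q)`.
-/

noncomputable section

/-! ### Positive self-adjoint operators as quotients of bounded operators -/

namespace Modular

section GraphPair

variable {E : Type*} [NormedAddCommGroup E] [InnerProductSpace ℂ E]

/-- The operator `D C⁻¹`, with graph `{(C x, D x) | x : E}`. It is meaningful for injective `C`. -/
def quotientOp (C D : E →L[ℂ] E) : E →ₗ.[ℂ] E :=
  (LinearMap.range (C.prod D).toLinearMap).toLinearPMap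

lemma mem_graph_quotientOp {C D : E →L[ℂ] E} (hC : Function.Injective C) {z : E × E} :
    z ∈ (quotientOp C D).graph ↔ ∃ x, C x = z.1 ∧ D x = z.2 := by
  rw [quotientOp, Submodule.toLinearPMap_graph_eq]
  · simp [Prod.ext_iff]
  · rintro _ ⟨x, rfl⟩ h
    have : x = 0 := hC (by simpa using h)
    simp [this]

lemma mem_graphRel {T : E →ₗ.[ℂ] E} {z : E × E} : z ∈ graphRel T ↔ z ∈ T.graph := Iff.rfl

lemma graphRel_injective : Function.Injective (graphRel (E := E)) := fun _ _ h =>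
  LinearPMap.eq_of_eq_graph (SetLike.coe_injective h)

variable [CompleteSpace E]

/-- Conditions on bounded operators `C`, `D` under which `D C⁻¹` is positive and self-adjoint.
The last one says that the pairs orthogonal to the graph `{(C x, D x)}` in the sense of the
adjoint belong to it. -/
structure IsGraphPair (C D : E →L[ℂ] E) : Prop where
  injective : Function.Injective C
  isSelfAdjoint_left : IsSelfAdjoint C
  isSelfAdjoint_right : IsSelfAdjoint D
  mul_nonneg : 0 ≤ C * D
  exists_lift : ∀ u w, C w = D u → ∃ y, C y = u ∧ D y = w

lemma inner_apply_comm {A : E →L[ℂ] E} (hA : IsSelfAdjoint A) (x y : E) :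
    ⟪A x, y⟫_ℂ = ⟪x, A y⟫_ℂ :=
  (ContinuousLinearMap.isSelfAdjoint_iff_isSymmetric.1 hA) x y

lemma denseRange_of_injective {A : E →L[ℂ] E} (hA : IsSelfAdjoint A)
    (hi : Function.Injective A) : DenseRange A := by
  have h : (LinearMap.range A.toLinearMap)ᗮ = ⊥ := by
    rw [Submodule.eq_bot_iff]
    intro x hx
    refine hi ?_
    rw [map_zero, ← inner_self_eq_zero (𝕜 := ℂ), inner_apply_comm hA]
    exact (Submodule.mem_orthogonal' _ _).1 hx _ ⟨A x, rfl⟩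
  exact (Submodule.dense_iff_topologicalClosure_eq_top (s := LinearMap.range A.toLinearMap)).2
    ((Submodule.topologicalClosure_eq_top_iff).2 h)

omit [CompleteSpace E] in
lemma inner_apply_self_nonneg {A : E →L[ℂ] E} (hA : 0 ≤ A) (x : E) : 0 ≤ (⟪x, A x⟫_ℂ).re :=
  ((ContinuousLinearMap.nonneg_iff_isPositive A).1 hA).re_inner_nonneg_right x

lemma mem_graph_adjoint_iff {T : E →ₗ.[ℂ] E} (hT : IsSelfAdjoint T) {u w : E} :
    (u, w) ∈ T.graph ↔ ∀ a b, (a, b) ∈ T.graph → ⟪b, u⟫_ℂ = ⟪a, w⟫_ℂ := by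
  have h := LinearPMap.adjoint_graph_eq_graph_adjoint hT.dense_domain
  rw [LinearPMap.isSelfAdjoint_def.1 hT] at h
  conv_lhs => rw [h]
  simp [sub_eq_zero]

lemma IsGraphPair.isPositiveSelfAdjoint {C D : E →L[ℂ] E} (h : IsGraphPair C D) :
    IsPositiveSelfAdjoint (quotientOp C D) := by
  have hd : Dense ((quotientOp C D).domain : Set E) := by
    refine (denseRange_of_injective h.isSelfAdjoint_left h.injective).mono ?_
    rintro _ ⟨x, rfl⟩
    exact LinearPMap.mem_domain_of_mem_graph
      ((mem_graph_quotientOp h.injective).2 ⟨x, rfl, rfl⟩)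
  have hc : ∀ x, C (D x) = D (C x) := by
    have h1 : IsSelfAdjoint (C * D) := h.mul_nonneg.isSelfAdjoint
    have h2 : C * D = D * C := by
      rw [← h1.star_eq, star_mul, h.isSelfAdjoint_left.star_eq, h.isSelfAdjoint_right.star_eq]
    exact fun x => congrArg (fun T : E →L[ℂ] E => T x) h2
  refine ⟨hd, ?_, fun x => ?_⟩
  · rw [LinearPMap.isSelfAdjoint_def]
    refine LinearPMap.eq_of_eq_graph ?_
    rw [LinearPMap.adjoint_graph_eq_graph_adjoint hd]
    ext ⟨u, w⟩
    rw [Submodule.mem_adjoint_iff, mem_graph_quotientOp h.injective]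
    refine ⟨fun H => h.exists_lift u w (ext_inner_left ℂ fun y => ?_), ?_⟩
    · have := H (C y) (D y) ((mem_graph_quotientOp h.injective).2 ⟨y, rfl, rfl⟩)
      rw [inner_apply_comm h.isSelfAdjoint_left, inner_apply_comm h.isSelfAdjoint_right,
        sub_eq_zero] at this
      exact this.symm
    · rintro ⟨x, hu, hw⟩ a b hab
      obtain ⟨y, ha, hb⟩ := (mem_graph_quotientOp h.injective).1 hab
      subst hu hw ha hb
      simp only
      rw [inner_apply_comm h.isSelfAdjoint_left, inner_apply_comm h.isSelfAdjoint_right, hc,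
        sub_self]
  · obtain ⟨y, h1, h2⟩ := (mem_graph_quotientOp h.injective).1 ((quotientOp C D).mem_graph x)
    simp only at h1 h2
    rw [← h1, ← h2, inner_apply_comm h.isSelfAdjoint_left]
    exact inner_apply_self_nonneg h.mul_nonneg y

end GraphPair

section Resolvent

variable {E : Type*} [NormedAddCommGroup E] [InnerProductSpace ℂ E] [CompleteSpace E]

/-- The bounded operators of the form `(1 + Δ)⁻¹` for a positive self-adjoint operator `Δ`. -/
structure IsContractiveResolvent (A : E →L[ℂ] E) : Prop where
  nonneg : 0 ≤ A
  le_one : A ≤ 1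
  injective : Function.Injective A

/-- The operator `A⁻¹ - 1`. -/
def ofResolvent (A : E →L[ℂ] E) : E →ₗ.[ℂ] E := quotientOp A (1 - A)

/-- The square root `(A⁻¹ - 1)^{1/2} = (1 - A)^{1/2} A^{-1/2}`. -/
def sqrtOfResolvent (A : E →L[ℂ] E) : E →ₗ.[ℂ] E := quotientOp (CFC.sqrt A) (CFC.sqrt (1 - A))

namespace IsContractiveResolvent

variable {A : E →L[ℂ] E} (hA : IsContractiveResolvent A)

include hA in
lemma sub_nonneg : 0 ≤ 1 - A := _root_.sub_nonneg.2 hA.le_one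

include hA in
lemma isSelfAdjoint : IsSelfAdjoint A := hA.nonneg.isSelfAdjoint

lemma commute_sqrt : Commute (CFC.sqrt A) (CFC.sqrt (1 - A)) := by
  have h : Commute A (1 - A) := (Commute.one_right A).sub_right (Commute.refl A)
  exact ((h.cfcₙ_nnreal NNReal.sqrt).symm.cfcₙ_nnreal NNReal.sqrt).symm

lemma sqrt_comm (x : E) :
    CFC.sqrt A (CFC.sqrt (1 - A) x) = CFC.sqrt (1 - A) (CFC.sqrt A x) :=
  congrArg (fun T : E →L[ℂ] E => T x) (commute_sqrt (A := A)).eq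

include hA

lemma sqrt_sqrt (x : E) : CFC.sqrt A (CFC.sqrt A x) = A x :=
  congrArg (fun T : E →L[ℂ] E => T x) (CFC.sqrt_mul_sqrt_self A hA.nonneg)

lemma sqrt_sub_sqrt_sub (x : E) : CFC.sqrt (1 - A) (CFC.sqrt (1 - A) x) = x - A x :=
  congrArg (fun T : E →L[ℂ] E => T x) (CFC.sqrt_mul_sqrt_self (1 - A) hA.sub_nonneg)

lemma injective_sqrt : Function.Injective (CFC.sqrt A : E →L[ℂ] E) := fun x y h =>
  hA.injective (by rw [← hA.sqrt_sqrt, ← hA.sqrt_sqrt, h])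

lemma isGraphPair : IsGraphPair A (1 - A) where
  injective := hA.injective
  isSelfAdjoint_left := hA.isSelfAdjoint
  isSelfAdjoint_right := hA.sub_nonneg.isSelfAdjoint
  mul_nonneg := Commute.mul_nonneg hA.nonneg hA.sub_nonneg
    ((Commute.one_right A).sub_right (Commute.refl A))
  exists_lift u w h := by
    refine ⟨u + w, ?_, ?_⟩ <;>
    simp only [sub_apply, one_apply_eq_self] at h ⊢ <;>
    rw [map_add, h] <;> abel

lemma isGraphPair_sqrt : IsGraphPair (CFC.sqrt A) (CFC.sqrt (1 - A)) where
  injective := hA.injective_sqrt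
  isSelfAdjoint_left := (CFC.sqrt_nonneg A).isSelfAdjoint
  isSelfAdjoint_right := (CFC.sqrt_nonneg (1 - A)).isSelfAdjoint
  mul_nonneg := Commute.mul_nonneg (CFC.sqrt_nonneg A) (CFC.sqrt_nonneg (1 - A))
    commute_sqrt
  exists_lift u w h := by
    refine ⟨CFC.sqrt A u + CFC.sqrt (1 - A) w, ?_, ?_⟩
    · rw [map_add, hA.sqrt_sqrt, sqrt_comm, h, hA.sqrt_sub_sqrt_sub]
      abel
    · rw [map_add, ← sqrt_comm, ← h, hA.sqrt_sqrt, hA.sqrt_sub_sqrt_sub]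
      abel

omit [CompleteSpace E] in
lemma mem_graph_ofResolvent {z : E × E} :
    z ∈ (ofResolvent A).graph ↔ ∃ x, A x = z.1 ∧ x - A x = z.2 :=
  mem_graph_quotientOp hA.injective

lemma mem_graph_sqrtOfResolvent {z : E × E} :
    z ∈ (sqrtOfResolvent A).graph ↔ ∃ x, CFC.sqrt A x = z.1 ∧ CFC.sqrt (1 - A) x = z.2 :=
  mem_graph_quotientOp hA.injective_sqrt

lemma isPositiveSelfAdjoint : IsPositiveSelfAdjoint (ofResolvent A) :=
  hA.isGraphPair.isPositiveSelfAdjoint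

lemma isPositiveSqrt : IsPositiveSqrt (ofResolvent A) (sqrtOfResolvent A) where
  isPositiveSelfAdjoint := hA.isGraphPair_sqrt.isPositiveSelfAdjoint
  mul_self := by
    ext ⟨x, w⟩
    change (∃ y, (x, y) ∈ _ ∧ (y, w) ∈ _) ↔ _
    simp only [mem_graphRel, hA.mem_graph_ofResolvent, hA.mem_graph_sqrtOfResolvent]
    constructor
    · rintro ⟨y, ⟨a, hx, hy⟩, ⟨b, hy', hw⟩⟩
      obtain ⟨e, ha, hb⟩ := hA.isGraphPair_sqrt.exists_lift a b (hy'.trans hy.symm)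
      subst hx hw ha hb
      exact ⟨e, (hA.sqrt_sqrt e).symm, (hA.sqrt_sub_sqrt_sub e).symm⟩
    · rintro ⟨e, rfl, rfl⟩
      exact ⟨CFC.sqrt (1 - A) (CFC.sqrt A e), ⟨CFC.sqrt A e, hA.sqrt_sqrt e, rfl⟩,
        CFC.sqrt (1 - A) e, sqrt_comm e, hA.sqrt_sub_sqrt_sub e⟩

/-- The vectors `A x` form a core of the square root. -/
lemma graph_sqrtOfResolvent_subset_closure :
    ((sqrtOfResolvent A).graph : Set (E × E))
      ⊆ closure (Set.range fun x => (A x, CFC.sqrt A (CFC.sqrt (1 - A) x))) := by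
  rintro z hz
  obtain ⟨x, h1, h2⟩ := hA.mem_graph_sqrtOfResolvent.1 hz
  have hx : x ∈ closure (Set.range (CFC.sqrt A : E →L[ℂ] E)) :=
    denseRange_of_injective (CFC.sqrt_nonneg A).isSelfAdjoint hA.injective_sqrt x
  have hc : Continuous fun x => (CFC.sqrt A x, CFC.sqrt (1 - A) x) := by fun_prop
  rw [show z = (CFC.sqrt A x, CFC.sqrt (1 - A) x) from Prod.ext h1.symm h2.symm]
  refine map_mem_closure (f := fun x => (CFC.sqrt A x, CFC.sqrt (1 - A) x)) hc hx ?_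
  rintro _ ⟨y, rfl⟩
  exact ⟨y, by simp only [hA.sqrt_sqrt, sqrt_comm]⟩

end IsContractiveResolvent

lemma eq_of_graph_subset {S T : E →ₗ.[ℂ] E} (hS : IsSelfAdjoint S) (hT : IsSelfAdjoint T)
    (h : S.graph ≤ T.graph) : T = S := by
  refine LinearPMap.eq_of_eq_graph (le_antisymm ?_ h)
  rintro ⟨u, w⟩ huw
  rw [mem_graph_adjoint_iff hT] at huw
  rw [mem_graph_adjoint_iff hS]
  exact fun a b hab => huw a b (h hab)

/-- Uniqueness of the positive square root `R`: the bounded operator `R A` is positive with square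
`A (1 - A)`, so it is determined by `A`, and `A E` is a core of the square root already found. -/
lemma IsContractiveResolvent.eq_sqrtOfResolvent {A : E →L[ℂ] E} (hA : IsContractiveResolvent A)
    {R : E →ₗ.[ℂ] E} (hR : IsPositiveSqrt (ofResolvent A) R) : R = sqrtOfResolvent A := by
  have hsa := hR.isPositiveSelfAdjoint.isSelfAdjoint
  have hsymm : ∀ a b c d : E, (a, b) ∈ R.graph → (c, d) ∈ R.graph → ⟪b, c⟫_ℂ = ⟪a, d⟫_ℂ :=
    fun a b c d h1 h2 => (mem_graph_adjoint_iff hsa).1 h2 a b h1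
  have hpos : ∀ a b : E, (a, b) ∈ R.graph → 0 ≤ (⟪a, b⟫_ℂ).re := by
    intro a b h
    obtain ⟨y, rfl, rfl⟩ := R.mem_graph_iff.1 h
    exact hR.isPositiveSelfAdjoint.nonneg y
  have hex : ∀ x, ∃ y, (A x, y) ∈ R.graph ∧ (y, x - A x) ∈ R.graph := by
    intro x
    have : (A x, x - A x) ∈ opMul (graphRel R) (graphRel R) := by
      rw [hR.mul_self]
      exact hA.mem_graph_ofResolvent.2 ⟨x, rfl, rfl⟩
    exact this
  -- `B₀ = R A`
  choose B₀ hB₁ hB₂ using hex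
  have huniq : ∀ {x y y' : E}, (x, y) ∈ R.graph → (x, y') ∈ R.graph → y = y' :=
    fun h h' => R.mem_graph_snd_inj h h' rfl
  let Bl : E →ₗ[ℂ] E :=
    { toFun := B₀
      map_add' := fun x y => huniq (hB₁ (x + y)) (by
        simpa using R.graph.add_mem (hB₁ x) (hB₁ y))
      map_smul' := fun c x => huniq (hB₁ (c • x)) (by
        simpa using R.graph.smul_mem c (hB₁ x)) }
  have hnorm : ∀ x, ‖B₀ x‖ ^ 2 ≤ ‖A‖ * (1 + ‖A‖) * ‖x‖ ^ 2 := by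
    intro x
    have h1 : (⟪B₀ x, B₀ x⟫_ℂ) = ⟪A x, x - A x⟫_ℂ := hsymm _ _ _ _ (hB₁ x) (hB₂ x)
    have h2 : ‖B₀ x‖ ^ 2 ≤ ‖A x‖ * ‖x - A x‖ := by
      have := norm_inner_le_norm (𝕜 := ℂ) (A x) (x - A x)
      rw [← h1, inner_self_eq_norm_sq_to_K] at this
      simpa using this
    have h3 : ‖x - A x‖ ≤ (1 + ‖A‖) * ‖x‖ := by
      refine (norm_sub_le _ _).trans ?_
      linarith [A.le_opNorm x]
    calc _ ≤ _ := h2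
      _ ≤ (‖A‖ * ‖x‖) * ((1 + ‖A‖) * ‖x‖) := by
        gcongr
        exact A.le_opNorm x
      _ = _ := by ring
  let B : E →L[ℂ] E := Bl.mkContinuous (Real.sqrt (‖A‖ * (1 + ‖A‖))) (by
    intro x
    refine le_of_sq_le_sq ?_ (by positivity)
    rw [mul_pow, Real.sq_sqrt (by positivity)]
    exact hnorm x)
  have hBpos : 0 ≤ B := by
    rw [ContinuousLinearMap.nonneg_iff_isPositive, ContinuousLinearMap.isPositive_def]
    -- Split `x = A x + R² A x` in the left argument, or `y` likewise in the right one.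
    have hdec : ∀ x y : E, ⟪x, B₀ y⟫_ℂ = ⟪A x, B₀ y⟫_ℂ + ⟪B₀ x, y - A y⟫_ℂ := by
      intro x y
      have h1 : ⟪x - A x, B₀ y⟫_ℂ = ⟪B₀ x, y - A y⟫_ℂ := hsymm _ _ _ _ (hB₂ x) (hB₂ y)
      rw [← h1, ← inner_add_left, add_sub_cancel]
    have hdec' : ∀ x y : E, ⟪B₀ x, y⟫_ℂ = ⟪A x, B₀ y⟫_ℂ + ⟪B₀ x, y - A y⟫_ℂ := by
      intro x y
      have h1 : ⟪B₀ x, A y⟫_ℂ = ⟪A x, B₀ y⟫_ℂ := hsymm _ _ _ _ (hB₁ x) (hB₁ y)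
      rw [← h1, ← inner_add_right, add_sub_cancel]
    refine ⟨fun x y => (hdec' x y).trans (hdec x y).symm, fun x => ?_⟩
    change 0 ≤ (⟪B₀ x, x⟫_ℂ).re
    rw [hdec', Complex.add_re]
    exact add_nonneg (hpos _ _ (hB₁ x)) (hpos _ _ (hB₂ x))
  -- `(1 + R²) u = v` forces `u = A v`.
  have hinj : ∀ u y w v, (u, y) ∈ R.graph → (y, w) ∈ R.graph → u + w = v → u = A v := by
    intro u y w v h1 h2 h3
    have : (u, w) ∈ graphRel (ofResolvent A) := by
      rw [← hR.mul_self]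
      exact ⟨y, h1, h2⟩
    obtain ⟨x, hx1, hx2⟩ := hA.mem_graph_ofResolvent.1 this
    simp only at hx1 hx2
    rw [← h3, ← hx1, ← hx2, add_sub_cancel]
  have hcomm : ∀ x, A (B₀ x) = B₀ (A x) := by
    intro x
    refine (hinj (B₀ (A x)) (A x - A (A x)) (B₀ x - B₀ (A x)) _ (hB₂ (A x)) ?_ (by abel)).symm
    simpa using R.graph.sub_mem (hB₁ x) (hB₁ (A x))
  have hBB : B * B = A * (1 - A) := by
    ext x
    change B₀ (B₀ x) = A (x - A x)
    refine huniq (hB₁ (B₀ x)) ?_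
    rw [hcomm, map_sub]
    exact hB₂ (A x)
  have hsq : B = CFC.sqrt A * CFC.sqrt (1 - A) := by
    have h1 := CFC.sqrt_unique hBB hBpos
    have h2 : CFC.sqrt (A * (1 - A)) = CFC.sqrt A * CFC.sqrt (1 - A) := by
      refine CFC.sqrt_unique ?_ hA.isGraphPair_sqrt.mul_nonneg
      ext x
      simp only [mul_apply_eq_comp, sub_apply, one_apply_eq_self, map_sub]
      rw [← IsContractiveResolvent.sqrt_comm (CFC.sqrt (1 - A) x), hA.sqrt_sub_sqrt_sub,
        hA.sqrt_sqrt, map_sub]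
    exact h1.symm.trans h2
  refine eq_of_graph_subset hA.isPositiveSqrt.isPositiveSelfAdjoint.isSelfAdjoint hsa ?_
  refine hA.graph_sqrtOfResolvent_subset_closure.trans (closure_minimal ?_ hsa.isClosed)
  rintro _ ⟨x, rfl⟩
  have : CFC.sqrt A (CFC.sqrt (1 - A) x) = B₀ x :=
    congrArg (fun T : E →L[ℂ] E => T x) hsq.symm
  simp only [this]
  exact hB₁ x

end Resolvent

end Modular

/-! ### Resolvents of antilinear involutions -/

namespace Modular

open ComplexConjugate

variable {E : Type*} [NormedAddCommGroup E] [InnerProductSpace ℂ E]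

lemma inner_antiunitary (J : E ≃ₗᵢ⋆[ℂ] E) (a b : E) : ⟪J a, J b⟫_ℂ = ⟪b, a⟫_ℂ := by
  have hre : ∀ a b : E, (⟪J a, J b⟫_ℂ).re = (⟪b, a⟫_ℂ).re := by
    intro a b
    have h1 := re_inner_eq_norm_add_mul_self_sub_norm_mul_self_sub_norm_mul_self_div_two
      (𝕜 := ℂ) (J a) (J b)
    have h2 := re_inner_eq_norm_add_mul_self_sub_norm_mul_self_sub_norm_mul_self_div_two
      (𝕜 := ℂ) b a
    rw [← map_add, J.norm_map, J.norm_map, J.norm_map] at h1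
    rw [add_comm b a] at h2
    refine h1.trans (Eq.trans ?_ h2.symm)
    ring
  refine Complex.ext (hre a b) ?_
  have := hre a (Complex.I • b)
  rw [map_smulₛₗ, inner_smul_right, inner_smul_left] at this
  simpa only [Complex.conj_I, neg_mul, Complex.neg_re, Complex.I_mul_re, neg_neg] using this

/-- The graphs of closed, densely defined antilinear operators equal to their inverse. -/
structure IsAntilinearInvolution (T : SetRel E E) : Prop where
  isClosed : IsClosed (T : Set (E × E))
  add_mem : ∀ {z w : E × E}, z ∈ T → w ∈ T → z + w ∈ T
  smul_mem : ∀ (c : ℂ) {x y : E}, (x, y) ∈ T → (c • x, conj c • y) ∈ T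
  dense : Dense {x | ∃ y, (x, y) ∈ T}
  eq_zero : ∀ {y : E}, ((0 : E), y) ∈ T → y = 0
  symm : ∀ {x y : E}, (x, y) ∈ T → (y, x) ∈ T

/-- `A = (1 + T^* T)⁻¹` for an antilinear operator `T`: `A z` is the vector `x` in the domain of
`T` with `z - x = T^* T x`. -/
def IsResolvent (T : SetRel E E) (A : E →L[ℂ] E) : Prop :=
  ∀ z, ∃ y, (A z, y) ∈ T ∧ ∀ u v, (u, v) ∈ T → ⟪z - A z, u⟫_ℂ = ⟪v, y⟫_ℂ

namespace IsAntilinearInvolution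

variable {T : SetRel E E} (hT : IsAntilinearInvolution T)

include hT

lemma neg_mem {x y : E} (h : (x, y) ∈ T) : (-x, -y) ∈ T := by
  simpa using hT.smul_mem (-1) h

lemma sub_mem {x y x' y' : E} (h : (x, y) ∈ T) (h' : (x', y') ∈ T) : (x - x', y - y') ∈ T := by
  simpa [sub_eq_add_neg] using hT.add_mem h (hT.neg_mem h')

lemma unique {x y y' : E} (h : (x, y) ∈ T) (h' : (x, y') ∈ T) : y = y' :=
  sub_eq_zero.1 (hT.eq_zero (by simpa using hT.sub_mem h h'))

lemma zero_mem : ((0 : E), (0 : E)) ∈ T := by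
  obtain ⟨x, y, h⟩ := hT.dense.nonempty
  simpa using hT.smul_mem 0 h

/-- The solution `x` of `z - x = T^* T x` is unique. -/
lemma eq_of_forall_inner {z x x' y y' : E} (h : (x, y) ∈ T) (h' : (x', y') ∈ T)
    (H : ∀ u v, (u, v) ∈ T → ⟪z - x, u⟫_ℂ = ⟪v, y⟫_ℂ)
    (H' : ∀ u v, (u, v) ∈ T → ⟪z - x', u⟫_ℂ = ⟪v, y'⟫_ℂ) : x = x' := by
  have h0 := hT.sub_mem h h'
  have h1 : ⟪z - x, x - x'⟫_ℂ - ⟪z - x', x - x'⟫_ℂ = ⟪y - y', y⟫_ℂ - ⟪y - y', y'⟫_ℂ := by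
    rw [H _ _ h0, H' _ _ h0]
  rw [← inner_sub_left, ← inner_sub_right, sub_sub_sub_cancel_left, ← neg_sub x x',
    inner_neg_left, inner_self_eq_norm_sq_to_K, inner_self_eq_norm_sq_to_K] at h1
  have h2 : -‖x - x'‖ ^ 2 = ‖y - y'‖ ^ 2 := by exact_mod_cast h1
  have h3 : ‖x - x'‖ ^ 2 = 0 := by nlinarith [sq_nonneg ‖x - x'‖, sq_nonneg ‖y - y'‖]
  exact sub_eq_zero.1 (norm_eq_zero.1 (pow_eq_zero_iff two_ne_zero |>.1 h3))

variable [CompleteSpace E]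

/-- The orthogonal projection of `(z, 0)` onto the graph, for the real inner product of
`E × E`, has first component `(1 + T^* T)⁻¹ z`. -/
lemma exists_isResolvent_aux (z : E) :
    ∃ x y, (x, y) ∈ T ∧ ∀ u v, (u, v) ∈ T → ⟪z - x, u⟫_ℂ = ⟪v, y⟫_ℂ := by
  let _inst : InnerProductSpace ℝ E := InnerProductSpace.complexToReal
  let K : Submodule ℝ (WithLp 2 (E × E)) :=
    { carrier := {v | (v.fst, v.snd) ∈ T}
      add_mem' := fun h h' => hT.add_mem h h'
      zero_mem' := hT.zero_mem
      smul_mem' := fun c v h => by simpa using hT.smul_mem (c : ℂ) h }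
  have hK : IsClosed (K : Set (WithLp 2 (E × E))) :=
    hT.isClosed.preimage (f := fun v : WithLp 2 (E × E) => (v.fst, v.snd)) (by fun_prop)
  have : CompleteSpace K := hK.completeSpace_coe
  let π := K.starProjection (WithLp.toLp 2 (z, 0))
  have hre : ∀ u v, (u, v) ∈ T → (⟪z - π.fst, u⟫_ℂ).re = (⟪v, π.snd⟫_ℂ).re := by
    intro u v huv
    have h := K.starProjection_inner_eq_zero (WithLp.toLp 2 (z, 0)) (WithLp.toLp 2 (u, v)) huv
    rw [WithLp.prod_inner_apply] at h
    have h2 : (⟪z - π.fst, u⟫_ℂ).re + (⟪0 - π.snd, v⟫_ℂ).re = 0 := h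
    rw [zero_sub, inner_neg_left, Complex.neg_re, ← inner_conj_symm π.snd, Complex.conj_re] at h2
    linarith
  refine ⟨π.fst, π.snd, K.starProjection_apply_mem _, fun u v huv => Complex.ext (hre u v huv) ?_⟩
  have := hre _ _ (hT.smul_mem Complex.I huv)
  rw [inner_smul_right, inner_smul_left] at this
  simpa only [Complex.conj_conj, Complex.I_mul_re, neg_inj]
    using this

lemma exists_isResolvent : ∃ A, IsResolvent T A := by
  choose A₀ y hA hy using hT.exists_isResolvent_aux
  let Al : E →ₗ[ℂ] E :=
    { toFun := A₀
      map_add' := fun z w => by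
        refine hT.eq_of_forall_inner (hA (z + w)) (hT.add_mem (hA z) (hA w)) (hy _) ?_
        intro u v huv
        rw [add_sub_add_comm, inner_add_left, hy z u v huv, hy w u v huv, ← inner_add_right]
      map_smul' := fun c z => by
        refine hT.eq_of_forall_inner (hA (c • z)) (hT.smul_mem c (hA z)) (hy _) ?_
        intro u v huv
        rw [RingHom.id_apply, ← smul_sub, inner_smul_left, hy z u v huv, ← inner_smul_right] }
  have hbound : ∀ z, ‖Al z‖ ≤ 1 * ‖z‖ := by
    intro z
    have h := hy z _ _ (hA z)
    rw [inner_sub_left, inner_self_eq_norm_sq_to_K, inner_self_eq_norm_sq_to_K] at h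
    have h1 := congrArg Complex.re h
    have h2 : (⟪z, A₀ z⟫_ℂ).re - ‖A₀ z‖ ^ 2 = ‖y z‖ ^ 2 := by
      rw [Complex.sub_re] at h1
      exact_mod_cast h1
    have h3 : (⟪z, A₀ z⟫_ℂ).re ≤ ‖z‖ * ‖A₀ z‖ := re_inner_le_norm (𝕜 := ℂ) z (A₀ z)
    change ‖A₀ z‖ ≤ 1 * ‖z‖
    rw [one_mul]
    rcases (norm_nonneg (A₀ z)).eq_or_lt with h0 | h0
    · rw [← h0]
      positivity
    · refine le_of_mul_le_mul_right ?_ h0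
      nlinarith [sq_nonneg ‖y z‖]
  exact ⟨Al.mkContinuous 1 hbound, fun z => ⟨y z, hA z, hy z⟩⟩

end IsAntilinearInvolution

namespace IsResolvent

variable {T : SetRel E E} {A : E →L[ℂ] E} (hA : IsResolvent T A) (hT : IsAntilinearInvolution T)

include hA hT

lemma apply_eq {x y z : E} (h : (x, y) ∈ T)
    (H : ∀ u v, (u, v) ∈ T → ⟪z - x, u⟫_ℂ = ⟪v, y⟫_ℂ) : A z = x := by
  obtain ⟨y', h', H'⟩ := hA z
  exact hT.eq_of_forall_inner h' h H' H

/-- The graph of `T^* T` is `{(A z, z - A z)}`. -/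
lemma mem_opMul_adjoint {x w : E} :
    (x, w) ∈ opMul (antilinearAdjoint T) T ↔ ∃ z, A z = x ∧ z - A z = w := by
  constructor
  · rintro ⟨y, hxy, hyw⟩
    have : A (x + w) = x := hA.apply_eq hT hxy fun u v huv => by
      rw [add_sub_cancel_left]
      exact hyw u v huv
    exact ⟨x + w, this, by rw [this, add_sub_cancel_left]⟩
  · rintro ⟨z, rfl, rfl⟩
    obtain ⟨y, h, H⟩ := hA z
    exact ⟨y, h, H⟩

/-- `T A T = 1 - A`, which amounts to `T (T^* T) T = (T^* T)⁻¹`. -/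
lemma apply_symm {x y z : E} (h : (x, y) ∈ T) (hz : (A x, z) ∈ T) : A y = y - z := by
  obtain ⟨z', hz', H⟩ := hA x
  obtain rfl := hT.unique hz hz'
  refine hA.apply_eq hT (hT.symm (hT.sub_mem h hz)) fun u v huv => ?_
  rw [sub_sub_cancel, ← inner_conj_symm, ← H v u (hT.symm huv), inner_conj_symm]

variable [CompleteSpace E]

lemma isContractiveResolvent : IsContractiveResolvent A := by
  choose y hy H using hA
  have hsymm : ∀ z w, ⟪z, A w⟫_ℂ = ⟪A z, A w⟫_ℂ + ⟪y w, y z⟫_ℂ := by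
    intro z w
    rw [← H z _ _ (hy w), ← inner_add_left, add_sub_cancel]
  have hsymm' : ∀ z w, ⟪A z, w⟫_ℂ = ⟪A z, A w⟫_ℂ + ⟪y w, y z⟫_ℂ := by
    intro z w
    rw [← inner_conj_symm, hsymm, map_add, inner_conj_symm, inner_conj_symm]
  refine ⟨?_, ?_, ?_⟩
  · rw [ContinuousLinearMap.nonneg_iff_isPositive, ContinuousLinearMap.isPositive_def]
    refine ⟨fun z w => (hsymm' z w).trans (hsymm z w).symm, fun z => ?_⟩
    change 0 ≤ (⟪A z, z⟫_ℂ).re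
    rw [hsymm', Complex.add_re]
    exact add_nonneg (inner_self_nonneg (𝕜 := ℂ)) (inner_self_nonneg (𝕜 := ℂ))
  · rw [← sub_nonneg, ContinuousLinearMap.nonneg_iff_isPositive,
      ContinuousLinearMap.isPositive_def]
    refine ⟨fun z w => ?_, fun z => ?_⟩
    · change ⟪z - A z, w⟫_ℂ = ⟪z, w - A w⟫_ℂ
      rw [inner_sub_left, inner_sub_right, hsymm, hsymm']
    · change 0 ≤ (⟪z - A z, z⟫_ℂ).re
      have h1 : ⟪z - A z, z⟫_ℂ = ⟪z - A z, z - A z⟫_ℂ + ⟪y z, y z⟫_ℂ := by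
        rw [← H z _ _ (hy z), ← inner_add_right, sub_add_cancel]
      rw [h1, Complex.add_re]
      exact add_nonneg (inner_self_nonneg (𝕜 := ℂ)) (inner_self_nonneg (𝕜 := ℂ))
  · rw [injective_iff_map_eq_zero]
    intro z hz
    have h0 := hy z
    rw [hz] at h0
    refine hT.dense.eq_zero_of_inner_left ℂ fun u hu => ?_
    obtain ⟨v, huv⟩ := hu
    have := H z u v huv
    rw [hz, hT.eq_zero h0] at this
    simpa using this

/-- A polar decomposition `T = J R` determines `T^* T = R²`. -/
lemma eq_ofResolvent {Δ R : E →ₗ.[ℂ] E} {J : E ≃ₗᵢ⋆[ℂ] E} (hR : IsPositiveSqrt Δ R)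
    (hJ : T = {z : E × E | ∃ x : R.domain, z = ((x : E), J (R x))}) : Δ = ofResolvent A := by
  have hsa := hR.isPositiveSelfAdjoint.isSelfAdjoint
  have hmem : ∀ {x y}, (x, y) ∈ R.graph → (x, J y) ∈ T := by
    intro x y h
    obtain ⟨x, rfl, rfl⟩ := R.mem_graph_iff.1 h
    rw [hJ]
    exact ⟨x, rfl⟩
  have hmem' : ∀ {x w}, (x, w) ∈ T → ∃ y, (x, y) ∈ R.graph ∧ w = J y := by
    intro x w h
    rw [hJ] at h
    obtain ⟨x, h⟩ := h
    obtain ⟨rfl, rfl⟩ := Prod.ext_iff.1 h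
    exact ⟨R x, R.mem_graph x, rfl⟩
  refine graphRel_injective ?_
  ext ⟨x, w⟩
  rw [← hR.mul_self, mem_graphRel, (hA.isContractiveResolvent hT).mem_graph_ofResolvent]
  constructor
  · rintro ⟨y, hxy, hyw⟩
    have : A (x + w) = x := hA.apply_eq hT (hmem hxy) fun u v huv => by
      obtain ⟨v, h, rfl⟩ := hmem' huv
      rw [add_sub_cancel_left, inner_antiunitary J, ← inner_conj_symm, ← inner_conj_symm y,
        (mem_graph_adjoint_iff hsa).1 hyw u v h]
    exact ⟨x + w, this, by rw [this, add_sub_cancel_left]⟩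
  · rintro ⟨z, rfl, rfl⟩
    obtain ⟨y, h, H⟩ := hA z
    obtain ⟨y, h', rfl⟩ := hmem' h
    refine ⟨y, h', (mem_graph_adjoint_iff hsa).2 fun a b hab => ?_⟩
    rw [← inner_conj_symm a, H a _ (hmem hab), inner_antiunitary J, inner_conj_symm]

end IsResolvent

end Modular

/-! ### Polar decomposition of antilinear involutions -/

namespace Modular

open ComplexConjugate

section Intertwining

variable {E F : Type*} [NormedAddCommGroup E] [InnerProductSpace ℂ E] [CompleteSpace E]
  [NormedAddCommGroup F] [InnerProductSpace ℂ F] [CompleteSpace F]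

/-- An antiunitary operator that intertwines two positive operators intertwines their
square roots. -/
lemma sqrt_antiunitary (J : E ≃ₗᵢ⋆[ℂ] E) {X Y : E →L[ℂ] E} (hX : 0 ≤ X)
    (h : ∀ z, X (J z) = J (Y z)) (z : E) : CFC.sqrt X (J z) = J (CFC.sqrt Y z) := by
  let W : E →L[ℂ] E :=
    { toFun := fun z => J.symm (CFC.sqrt X (J z))
      map_add' := fun a b => by simp
      map_smul' := fun c a => by simp [map_smulₛₗ]
      cont := by fun_prop }
  have hsa : IsSelfAdjoint (CFC.sqrt X) := (CFC.sqrt_nonneg X).isSelfAdjoint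
  have hJ : ∀ a b, ⟪J.symm a, b⟫_ℂ = ⟪J b, a⟫_ℂ := fun a b => by
    rw [← inner_antiunitary J, J.apply_symm_apply]
  have hJ' : ∀ a b, ⟪a, J.symm b⟫_ℂ = ⟪b, J a⟫_ℂ := fun a b => by
    rw [← inner_antiunitary J, J.apply_symm_apply]
  have hW : 0 ≤ W := by
    rw [ContinuousLinearMap.nonneg_iff_isPositive, ContinuousLinearMap.isPositive_def]
    refine ⟨fun a b => ?_, fun a => ?_⟩
    · change ⟪J.symm (CFC.sqrt X (J a)), b⟫_ℂ = ⟪a, J.symm (CFC.sqrt X (J b))⟫_ℂ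
      rw [hJ, hJ', inner_apply_comm hsa]
    · change 0 ≤ (⟪J.symm (CFC.sqrt X (J a)), a⟫_ℂ).re
      rw [hJ]
      exact inner_apply_self_nonneg (CFC.sqrt_nonneg X) _
  have hWW : W * W = Y := by
    ext a
    change J.symm (CFC.sqrt X (J (J.symm (CFC.sqrt X (J a))))) = Y a
    rw [J.apply_symm_apply, J.symm_apply_eq, ← h]
    exact congrArg (fun T : E →L[ℂ] E => T (J a)) (CFC.sqrt_mul_sqrt_self X hX)
  rw [CFC.sqrt_unique hWW hW]
  exact (J.apply_symm_apply _).symm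

/-- An isometry that intertwines two positive operators intertwines their square roots. -/
lemma sqrt_isometry (V : F →ₗᵢ[ℂ] E) {X : E →L[ℂ] E} {Y : F →L[ℂ] F} (hX : 0 ≤ X) (hY : 0 ≤ Y)
    (h : ∀ z, X (V z) = V (Y z)) (z : F) : CFC.sqrt X (V z) = V (CFC.sqrt Y z) := by
  let v : F →L[ℂ] E := V.toContinuousLinearMap
  have hv : ∀ x, v.adjoint (V x) = x := fun x => ext_inner_right ℂ fun y => by
    rw [ContinuousLinearMap.adjoint_inner_left]
    exact V.inner_map_map x y
  have hadj : ∀ x, v.adjoint (X x) = Y (v.adjoint x) := fun x => ext_inner_right ℂ fun y => by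
    rw [ContinuousLinearMap.adjoint_inner_left, inner_apply_comm hX.isSelfAdjoint,
      inner_apply_comm hY.isSelfAdjoint, ContinuousLinearMap.adjoint_inner_left]
    exact congrArg _ (h y)
  have hcomm : Commute X (v ∘L v.adjoint) := by
    ext x
    change X (V (v.adjoint x)) = V (v.adjoint (X x))
    rw [h, hadj]
  have hcomm' : ∀ x, CFC.sqrt X (V (v.adjoint x)) = V (v.adjoint (CFC.sqrt X x)) := fun x =>
    congrArg (fun T : E →L[ℂ] E => T x) (hcomm.cfcₙ_nnreal NNReal.sqrt).eq
  have hV : ∀ x, CFC.sqrt X (V x) = V (v.adjoint (CFC.sqrt X (V x))) := fun x => by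
    rw [← hcomm', hv]
  let W : F →L[ℂ] F := v.adjoint ∘L CFC.sqrt X ∘L v
  have hW : 0 ≤ W := by
    rw [ContinuousLinearMap.nonneg_iff_isPositive]
    exact ((ContinuousLinearMap.nonneg_iff_isPositive _).1 (CFC.sqrt_nonneg X)).adjoint_conj v
  have hWW : W * W = Y := by
    ext x
    change v.adjoint (CFC.sqrt X (V (v.adjoint (CFC.sqrt X (V x))))) = Y x
    rw [← hV]
    have := congrArg (fun T : E →L[ℂ] E => T (V x)) (CFC.sqrt_mul_sqrt_self X hX)
    change CFC.sqrt X (CFC.sqrt X (V x)) = X (V x) at this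
    rw [this, hadj, hv]
  rw [CFC.sqrt_unique hWW hW]
  exact hV z

/-- An isometry that intertwines the resolvents maps the graph of the one square root into the
graph of the other. -/
lemma map_mem_graph_sqrtOfResolvent (V : F →ₗᵢ[ℂ] E) {A : E →L[ℂ] E} {B : F →L[ℂ] F}
    (hA : IsContractiveResolvent A) (hB : IsContractiveResolvent B)
    (h : ∀ z, A (V z) = V (B z)) {x y : F} (hxy : (x, y) ∈ (sqrtOfResolvent B).graph) :
    (V x, V y) ∈ (sqrtOfResolvent A).graph := by
  obtain ⟨e, h1, h2⟩ := hB.mem_graph_sqrtOfResolvent.1 hxy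
  subst h1 h2
  refine hA.mem_graph_sqrtOfResolvent.2 ⟨V e, ?_, ?_⟩
  · exact sqrt_isometry V hA.nonneg hB.nonneg h e
  · refine sqrt_isometry V hA.sub_nonneg hB.sub_nonneg (fun z => ?_) e
    change V z - A (V z) = V (z - B z)
    rw [h, map_sub]

end Intertwining

variable {E : Type*} [NormedAddCommGroup E] [InnerProductSpace ℂ E] [CompleteSpace E]

/-- Polar decomposition of an antilinear involution `T` with resolvent `A`. The antiunitary part
`J` sends `R A z` to `T A z`, where `R` is the positive part and `A E` is a core of `R`; the
relation `T A T = 1 - A` gives `A J = J (1 - A)`, and from this `J` is an involution and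
`J R` is all of `T`. -/
theorem IsResolvent.exists_polar {T : SetRel E E} {A : E →L[ℂ] E} (hA : IsResolvent T A)
    (hT : IsAntilinearInvolution T) :
    ∃ J : E ≃ₗᵢ⋆[ℂ] E, (∀ x, J (J x) = x) ∧
      T = {z : E × E | ∃ x : (sqrtOfResolvent A).domain,
        z = ((x : E), J (sqrtOfResolvent A x))} := by
  have hc := hA.isContractiveResolvent hT
  have hsymm : ∀ {x x' z : E}, (x, x') ∈ T → (A x, z) ∈ T → A x' = x' - z :=
    fun h h' => hA.apply_symm hT h h'
  choose y hy H using id hA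
  let B : E →L[ℂ] E := CFC.sqrt A * CFC.sqrt (1 - A)
  have hBsa : IsSelfAdjoint B := hc.isGraphPair_sqrt.mul_nonneg.isSelfAdjoint
  have hB : ∀ x, B x = CFC.sqrt A (CFC.sqrt (1 - A) x) := fun _ => rfl
  have hBB : ∀ x, B (B x) = A x - A (A x) := fun x => by
    rw [hB, hB, ← IsContractiveResolvent.sqrt_comm (CFC.sqrt (1 - A) x), hc.sqrt_sub_sqrt_sub,
      hc.sqrt_sqrt, map_sub]
  let f : E →ₗ⋆[ℂ] E :=
    { toFun := y
      map_add' := fun z w => hT.unique (hy (z + w)) (by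
        rw [map_add]
        exact hT.add_mem (hy z) (hy w))
      map_smul' := fun c z => hT.unique (hy (c • z)) (by
        rw [map_smul]
        exact hT.smul_mem c (hy z)) }
  have hyinj : ∀ z, y z = 0 → z = 0 := by
    intro z hz
    have := hT.symm (hy z)
    rw [hz] at this
    exact (injective_iff_map_eq_zero A).1 hc.injective z (hT.eq_zero this)
  have hnorm : ∀ z, ‖y z‖ = ‖B z‖ := by
    intro z
    have h1 : ⟪y z, y z⟫_ℂ = ⟪B z, B z⟫_ℂ := by
      rw [← H z _ _ (hy z), inner_apply_comm hBsa, hBB, inner_sub_left, inner_sub_right,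
        inner_apply_comm hc.isSelfAdjoint]
    rw [inner_self_eq_norm_sq_to_K, inner_self_eq_norm_sq_to_K] at h1
    have h2 : ‖y z‖ ^ 2 = ‖B z‖ ^ 2 := by exact_mod_cast h1
    exact (pow_left_inj₀ (norm_nonneg _) (norm_nonneg _) two_ne_zero).1 h2
  have hBd : DenseRange B := denseRange_of_injective hBsa
    ((injective_iff_map_eq_zero B).2 fun z hz => hyinj z (norm_eq_zero.1 (by
      rw [hnorm, hz, norm_zero])))
  have hyd : DenseRange y := by
    have hinj : Function.Injective (1 - A : E →L[ℂ] E) := by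
      refine (injective_iff_map_eq_zero (1 - A : E →L[ℂ] E)).2 fun z hz => hyinj z ?_
      have h1 := H z _ _ (hy z)
      rw [show z - A z = 0 from hz, inner_zero_left] at h1
      exact inner_self_eq_zero.1 h1.symm
    have hd : Dense ((1 - A : E →L[ℂ] E) '' {x | ∃ x', (x, x') ∈ T}) :=
      (denseRange_of_injective hc.sub_nonneg.isSelfAdjoint hinj).dense_image
        (1 - A : E →L[ℂ] E).continuous hT.dense
    refine hd.mono ?_
    rintro _ ⟨x', ⟨x, hx⟩, rfl⟩
    refine ⟨x, ?_⟩
    change y x = x' - A x'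
    rw [hsymm (hT.symm hx) (hy x), sub_sub_cancel]
  let e := LinearEquiv.ofInjective f ((injective_iff_map_eq_zero f).2 hyinj)
  have hed : DenseRange (LinearMap.range f).subtype := by
    rw [DenseRange, Submodule.coe_subtype, Subtype.range_coe]
    exact hyd
  let J : E ≃ₗᵢ⋆[ℂ] E := e.extendOfIsometry B.toLinearMap (LinearMap.range f).subtype hBd hed hnorm
  have hJB : ∀ z, J (B z) = y z := fun z =>
    e.extendOfIsometry_eq B.toLinearMap (LinearMap.range f).subtype hBd hed hnorm z
  have hext : ∀ {g₁ g₂ : E → E}, Continuous g₁ → Continuous g₂ → (∀ z, g₁ (B z) = g₂ (B z)) →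
      ∀ z, g₁ z = g₂ z := fun h₁ h₂ h z =>
    congrFun (hBd.equalizer h₁ h₂ (funext h)) z
  have hAJ : ∀ z, A (J z) = J ((1 - A) z) := by
    refine hext (by fun_prop) (by fun_prop) fun z => ?_
    have h1 : B z - A (B z) = B (z - A z) := by
      rw [map_sub, sub_right_inj]
      rw [← hc.sqrt_sqrt, ← hc.sqrt_sqrt z, hB, hB, IsContractiveResolvent.sqrt_comm,
        ← IsContractiveResolvent.sqrt_comm (CFC.sqrt A z)]
    change A (J (B z)) = J (B z - A (B z))
    rw [h1, hJB, hJB, hsymm (hy z) (hy (A z))]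
    exact (map_sub f z (A z)).symm
  have hsq : ∀ z, CFC.sqrt A (J z) = J (CFC.sqrt (1 - A) z) := sqrt_antiunitary J hc.nonneg hAJ
  have hsq' : ∀ z, CFC.sqrt (1 - A) (J z) = J (CFC.sqrt A z) := by
    refine sqrt_antiunitary J hc.sub_nonneg fun z => ?_
    change J z - A (J z) = J (A z)
    rw [hAJ, ← map_sub]
    change J (z - (z - A z)) = _
    rw [sub_sub_cancel]
  have hBJ : ∀ z, B (J z) = J (B z) := fun z => by
    rw [hB, hsq', hsq, hB, IsContractiveResolvent.sqrt_comm]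
  have hyT : ∀ {x x'}, (x, x') ∈ T → J (B x) = x' - A x' := fun h => by
    rw [hJB, hsymm h (hy _), sub_sub_cancel]
  have hJJ : ∀ z, J (J z) = z := by
    have h2 : ∀ z, J (J (B (B z))) = B (B z) := by
      intro z
      rw [← hBJ (B z), hJB z, hyT (hT.symm (hy z)), hBB]
    refine hext (by fun_prop) (by fun_prop) fun z => ?_
    exact hext (g₁ := fun z => J (J (B z))) (g₂ := fun z => B z) (by fun_prop) (by fun_prop) h2 z
  refine ⟨J, hJJ, Set.Subset.antisymm ?_ ?_⟩
  · rintro ⟨x, x'⟩ hx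
    have hx' := hT.symm hx
    have hg : (x, J x') ∈ (sqrtOfResolvent A).graph := by
      refine hc.mem_graph_sqrtOfResolvent.2 ⟨CFC.sqrt A x + CFC.sqrt (1 - A) (J x'), ?_, ?_⟩
      · rw [map_add, hc.sqrt_sqrt, ← hB, hBJ, hyT hx', add_sub_cancel]
      · rw [map_add, ← IsContractiveResolvent.sqrt_comm, ← hB, hc.sqrt_sub_sqrt_sub]
        rw [← hJJ (B x), hyT hx, hAJ, map_sub]
        change J x' - J (A x') + (J x' - J (x' - A x')) = J x'
        rw [map_sub]
        abel
    obtain ⟨u, rfl, hu⟩ := (sqrtOfResolvent A).mem_graph_iff.1 hg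
    refine ⟨u, ?_⟩
    rw [hu, hJJ]
  · rintro _ ⟨x, rfl⟩
    have hcore := hc.graph_sqrtOfResolvent_subset_closure ((sqrtOfResolvent A).mem_graph x)
    have hcont : Continuous fun z : E × E => (z.1, J z.2) := by fun_prop
    have := map_mem_closure hcont hcore (t := T) (by
      rintro _ ⟨z, rfl⟩
      change (A z, J (B z)) ∈ T
      rw [hJB]
      exact hy z)
    rwa [hT.isClosed.closure_eq] at this

end Modular

/-! ### The one-particle operators -/

namespace Modular

open ComplexConjugate

variable {E : Type*} [NormedAddCommGroup E] [InnerProductSpace ℂ E]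

/-- The negative `-T` of an operator `T` given by its graph. -/
def negRel (T : SetRel E E) : SetRel E E := {z | (z.1, -z.2) ∈ T}

lemma isClosed_antilinearAdjoint (T : SetRel E E) :
    IsClosed (antilinearAdjoint T : Set (E × E)) := by
  simp only [antilinearAdjoint, Set.ofPred_forall]
  refine isClosed_iInter fun y => isClosed_iInter fun w => isClosed_iInter fun _ => ?_
  exact isClosed_eq (by fun_prop) (by fun_prop)

lemma antilinearAdjoint_negRel (T : SetRel E E) :
    antilinearAdjoint (negRel T) = negRel (antilinearAdjoint T) := by
  ext ⟨x, z⟩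
  constructor
  · intro h y w hyw
    have := h y (-w) (by simpa [negRel] using hyw)
    rw [inner_neg_left] at this
    rw [inner_neg_left, this, neg_neg]
  · intro h y w hyw
    have := h y (-w) hyw
    simpa using this

omit [InnerProductSpace ℂ E] in
lemma negRel_negRel (T : SetRel E E) : negRel (negRel T) = T := by
  ext ⟨x, z⟩
  simp [negRel]

lemma IsAntilinearInvolution.negRel {T : SetRel E E} (hT : IsAntilinearInvolution T) :
    IsAntilinearInvolution (negRel T) where
  isClosed := hT.isClosed.preimage (f := fun z : E × E => (z.1, -z.2)) (by fun_prop)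
  add_mem {z w} h h' := by
    have := hT.add_mem h h'
    simpa [Modular.negRel, add_comm] using this
  smul_mem c x y h := by
    have := hT.smul_mem c h
    simpa [Modular.negRel] using this
  dense := hT.dense.mono (by
    rintro x ⟨y, hy⟩
    exact ⟨-y, by simpa [Modular.negRel] using hy⟩)
  eq_zero h := neg_eq_zero.1 (hT.eq_zero h)
  symm {x y} h := by
    have := hT.neg_mem (hT.symm h)
    simpa [Modular.negRel] using this

lemma IsResolvent.negRel {T : SetRel E E} {A : E →L[ℂ] E} (hA : IsResolvent T A) :
    IsResolvent (negRel T) A := fun z => by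
  obtain ⟨y, hy, H⟩ := hA z
  refine ⟨-y, by simpa [Modular.negRel] using hy, fun u v huv => ?_⟩
  rw [H u (-v) huv, inner_neg_left, inner_neg_right]

end Modular

namespace CAR

open Modular ComplexConjugate

variable {H : Type*} [NormedAddCommGroup H] [InnerProductSpace ℂ H]
  {Γ : H ≃ₗᵢ⋆[ℂ] H} (hΓ : ∀ x, Γ (Γ x) = x) {p : Submodule ℂ H} [p.HasOrthogonalProjection]
  (hp : IsBasisProjection Γ p)

section BasisProjection

lemma inner_conjugation (hΓ : ∀ x, Γ (Γ x) = x) (a b : H) : ⟪Γ a, b⟫_ℂ = ⟪Γ b, a⟫_ℂ := by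
  rw [← inner_antiunitary Γ, hΓ]

lemma conjugation_mem_orthogonal (hΓ : ∀ x, Γ (Γ x) = x) {q : Submodule ℂ H}
    (hq : ∀ x ∈ q, Γ x ∈ q) {x : H} (hx : x ∈ qᗮ) : Γ x ∈ qᗮ := by
  rw [Submodule.mem_orthogonal'] at hx ⊢
  intro u hu
  rw [inner_conjugation hΓ, ← inner_conj_symm, hx _ (hq u hu), map_zero]

include hp in
lemma conjugation_projection_conjugation (x : H) :
    Γ (p.orthogonalProjectionOnto (Γ x)) = x - p.orthogonalProjectionOnto x :=
  eq_sub_of_add_eq' (hp x)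

include hp in
/-- `Γ` maps `p` into its orthogonal complement. -/
lemma projection_conjugation_of_mem (u : p) : p.orthogonalProjectionOnto (Γ u) = 0 := by
  have h := conjugation_projection_conjugation hp (u : H)
  rw [p.orthogonalProjectionOnto_mem_subspace_eq_self, sub_self, ← map_zero Γ] at h
  exact Subtype.ext (Γ.injective h)

include hΓ hp in
/-- The sesquilinear form of the identity `Γ P Γ = 1 - P`. -/
lemma inner_projection_conjugation_eq (x f : H) :
    ⟪p.orthogonalProjectionOnto (Γ f), p.orthogonalProjectionOnto x⟫_ℂ
      = ⟪Γ f, x⟫_ℂ - ⟪p.orthogonalProjectionOnto (Γ x), p.orthogonalProjectionOnto f⟫_ℂ := by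
  rw [p.inner_orthogonalProjectionOnto_eq_of_mem_left,
    p.inner_orthogonalProjectionOnto_eq_of_mem_right, ← inner_antiunitary Γ,
    conjugation_projection_conjugation hp, inner_sub_right, ← inner_conjugation hΓ f x]

end BasisProjection

section OneParticle

include hΓ hp

/-- `β^* = α`. -/
lemma antilinearAdjoint_beta {q : Submodule ℂ H} (hq : ∀ x ∈ q, Γ x ∈ q) :
    antilinearAdjoint (beta Γ p q) = alpha Γ p q := by
  ext ⟨u, w⟩
  constructor
  · intro h
    -- `P Γ` vanishes on `p`, so `x = u - Γ w` has `P x = u` and `-P Γ x = w`.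
    refine ⟨u - Γ w, ?_, ?_⟩
    · rw [Submodule.mem_orthogonal']
      intro f hf
      have := h _ _ ⟨Γ f, hq f hf, rfl⟩
      simp only [hΓ] at this
      rw [p.inner_orthogonalProjectionOnto_eq_of_mem_left,
        p.inner_orthogonalProjectionOnto_eq_of_mem_right, ← inner_conj_symm,
        inner_conjugation hΓ] at this
      rw [inner_sub_left, ← inner_conj_symm, ← this, Complex.conj_conj, sub_self]
    · rw [map_sub, map_sub, hΓ, map_sub, projection_conjugation_of_mem hp,
        projection_conjugation_of_mem hp, p.orthogonalProjectionOnto_mem_subspace_eq_self,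
        p.orthogonalProjectionOnto_mem_subspace_eq_self]
      simp
  · rintro ⟨x, hx, h⟩ _ _ ⟨f, hf, h'⟩
    obtain ⟨rfl, rfl⟩ := Prod.ext_iff.1 h
    obtain ⟨rfl, rfl⟩ := Prod.ext_iff.1 h'
    simp only
    rw [inner_projection_conjugation_eq hΓ hp, (Submodule.mem_orthogonal _ _).1 hx _ (hq f hf),
      inner_neg_left, zero_sub]

omit hΓ hp in
lemma beta_orthogonal_eq {q : Submodule ℂ H} : negRel (beta Γ p qᗮ) = alpha Γ p q := by
  ext ⟨u, w⟩
  simp [negRel, beta, alpha, neg_eq_iff_eq_neg]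

/-- `α^* = β`. -/
lemma antilinearAdjoint_alpha {q : Submodule ℂ H} [q.HasOrthogonalProjection]
    (hq : ∀ x ∈ q, Γ x ∈ q) : antilinearAdjoint (alpha Γ p q) = beta Γ p q := by
  rw [← beta_orthogonal_eq, antilinearAdjoint_negRel,
    antilinearAdjoint_beta hΓ hp fun x hx => conjugation_mem_orthogonal hΓ hq hx,
    ← beta_orthogonal_eq, negRel_negRel, Submodule.orthogonal_orthogonal]

omit hΓ hp in
lemma dense_projection [CompleteSpace p] {q : Submodule ℂ H} (hpq' : p ⊓ qᗮ = ⊥) :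
    Dense (p.orthogonalProjectionOnto '' q) := by
  have h : (q.map p.orthogonalProjectionOnto.toLinearMap)ᗮ = ⊥ := by
    rw [Submodule.eq_bot_iff]
    intro u hu
    have : (u : H) ∈ p ⊓ qᗮ := by
      refine ⟨u.2, (Submodule.mem_orthogonal' _ _).2 fun f hf => ?_⟩
      rw [← p.inner_orthogonalProjectionOnto_eq_of_mem_left]
      exact (Submodule.mem_orthogonal' _ _).1 hu _ ⟨f, hf, rfl⟩
    rw [hpq', Submodule.mem_bot] at this
    exact Subtype.ext this
  exact Submodule.dense_iff_topologicalClosure_eq_top.2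
    (Submodule.topologicalClosure_eq_top_iff.2 h)

/-- Generic position makes `β` a closed, densely defined antilinear involution. -/
lemma isAntilinearInvolution_beta [CompleteSpace p] {q : Submodule ℂ H}
    [q.HasOrthogonalProjection] (hq : ∀ x ∈ q, Γ x ∈ q) (hpq : p ⊓ q = ⊥) (hpq' : p ⊓ qᗮ = ⊥) :
    IsAntilinearInvolution (beta Γ p q) where
  isClosed := by
    rw [← antilinearAdjoint_alpha hΓ hp hq]
    exact isClosed_antilinearAdjoint _
  add_mem := by
    rintro _ _ ⟨x, hx, rfl⟩ ⟨y, hy, rfl⟩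
    exact ⟨x + y, add_mem hx hy, by simp⟩
  smul_mem := by
    rintro c _ _ ⟨x, hx, h⟩
    obtain ⟨rfl, rfl⟩ := Prod.ext_iff.1 h
    exact ⟨c • x, q.smul_mem c hx, by simp [map_smulₛₗ]⟩
  dense := (dense_projection hpq').mono (by
    rintro _ ⟨x, hx, rfl⟩
    exact ⟨_, x, hx, rfl⟩)
  eq_zero := by
    rintro _ ⟨x, hx, h⟩
    obtain ⟨h0, rfl⟩ := Prod.ext_iff.1 h
    have h1 := conjugation_projection_conjugation hp x
    simp only at h0
    rw [← h0, ZeroMemClass.coe_zero, sub_zero] at h1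
    have h2 : Γ x ∈ p ⊓ q := by
      refine ⟨?_, hq x hx⟩
      rw [← h1, hΓ]
      exact Submodule.coe_mem _
    rw [hpq, Submodule.mem_bot] at h2
    simp [h2]
  symm := by
    rintro _ _ ⟨x, hx, h⟩
    obtain ⟨rfl, rfl⟩ := Prod.ext_iff.1 h
    exact ⟨Γ x, hq x hx, by rw [hΓ]⟩

omit hΓ hp in
/-- The compression `P Q P` of the projection onto `q` to `p`. -/
def compression (p q : Submodule ℂ H) [p.HasOrthogonalProjection] [q.HasOrthogonalProjection] :
    p →L[ℂ] p :=
  p.orthogonalProjectionOnto ∘L q.starProjection ∘L p.subtypeL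

omit hΓ hp in
lemma compression_apply {q : Submodule ℂ H} [q.HasOrthogonalProjection] (z : p) :
    compression p q z = p.orthogonalProjectionOnto (q.starProjection z) := rfl

omit hΓ hp in
lemma sub_compression_apply {q : Submodule ℂ H} [q.HasOrthogonalProjection] (z : p) :
    z - compression p q z = compression p qᗮ z := by
  rw [compression_apply, compression_apply, Submodule.starProjection_orthogonal',
    sub_apply, one_apply_eq_self, map_sub,
    p.orthogonalProjectionOnto_mem_subspace_eq_self]

/-- `P Q P = (1 + β^* β)⁻¹`. -/
lemma isResolvent_beta {q : Submodule ℂ H} [q.HasOrthogonalProjection] :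
    IsResolvent (beta Γ p q) (compression p q) := by
  intro z
  refine ⟨_, ⟨q.starProjection z, q.starProjection_apply_mem _, rfl⟩, ?_⟩
  rintro _ _ ⟨f, hf, h⟩
  obtain ⟨rfl, rfl⟩ := Prod.ext_iff.1 h
  simp only
  have h1 := inner_projection_conjugation_eq hΓ hp (p := p) (Γ (q.starProjection z)) f
  rw [hΓ, inner_antiunitary Γ] at h1
  rw [h1, inner_sub_left, compression_apply, p.inner_orthogonalProjectionOnto_eq_of_mem_left,
    q.inner_starProjection_left_eq_right, q.starProjection_eq_self_iff.2 hf]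

end OneParticle

end CAR

/-! ### The antisymmetric Fock space -/

namespace Fock

open UniformSpace (Completion)

variable {K : Type*} [NormedAddCommGroup K] [InnerProductSpace ℂ K]

section CoeLemmas

lemma creation_coe (v : K) (x : ExteriorAlgebra ℂ K) :
    creation v (x : FockSpace K)
      = ((ExteriorAlgebra.ι ℂ v * x : ExteriorAlgebra ℂ K) : FockSpace K) :=
  extendCLM_coe _ _

lemma annihilation_coe (v : K) (x : ExteriorAlgebra ℂ K) :
    annihilation v (x : FockSpace K) = (contract v x : FockSpace K) :=
  extendCLM_coe _ _

lemma clm_ext {S T : FockSpace K →L[ℂ] FockSpace K}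
    (h : ∀ x : ExteriorAlgebra ℂ K, S (x : FockSpace K) = T (x : FockSpace K)) : S = T :=
  ContinuousLinearMap.coeFn_injective
    (Completion.denseRange_coe.equalizer S.continuous T.continuous (funext h))

lemma creation_vacuum (v : K) : creation v (vacuum K) = oneParticle v := by
  rw [vacuum, creation_coe, mul_one, oneParticle]

lemma annihilation_vacuum (v : K) : annihilation v (vacuum K) = 0 := by
  have := contract_algebraMap v 1
  rw [map_one] at this
  rw [vacuum, annihilation_coe, this, Completion.coe_zero]

end CoeLemmas

section AnticommutationRelations

lemma creation_mul_creation (v w : K) :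
    creation v * creation w = -(creation w * creation v) := by
  refine clm_ext fun x => ?_
  have h : ExteriorAlgebra.ι ℂ v * ExteriorAlgebra.ι ℂ w
      = -(ExteriorAlgebra.ι ℂ w * ExteriorAlgebra.ι ℂ v) :=
    eq_neg_of_add_eq_zero_left (ExteriorAlgebra.ι_add_mul_swap v w)
  change creation v (creation w _) = -(creation w (creation v _))
  rw [creation_coe, creation_coe, creation_coe, creation_coe, ← mul_assoc, h, neg_mul, mul_assoc,
    Completion.coe_neg]

lemma annihilation_mul_annihilation (v w : K) :
    annihilation v * annihilation w = -(annihilation w * annihilation v) := by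
  rw [← star_creation, ← star_creation, ← star_mul, creation_mul_creation, star_neg, star_mul]

lemma annihilation_mul_creation (v w : K) :
    annihilation v * creation w = ⟪v, w⟫_ℂ • 1 - creation w * annihilation v := by
  refine clm_ext fun x => ?_
  change annihilation v (creation w _)
    = ⟪v, w⟫_ℂ • (x : FockSpace K) - creation w (annihilation v _)
  rw [creation_coe, annihilation_coe, annihilation_coe, creation_coe, contract_ι_mul,
    Completion.coe_sub, Completion.coe_smul]

end AnticommutationRelations

section OneParticle

lemma inner_oneParticle (v w : K) : ⟪oneParticle v, oneParticle w⟫_ℂ = ⟪v, w⟫_ℂ := by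
  have h := congrArg (fun T : FockSpace K →L[ℂ] FockSpace K => T (vacuum K))
    (annihilation_mul_creation v w)
  change annihilation v (creation w _) = ⟪v, w⟫_ℂ • vacuum K - creation w (annihilation v _) at h
  have h1 : ⟪vacuum K, vacuum K⟫_ℂ = 1 := by
    rw [vacuum, Completion.inner_coe, inner_eq_innerForm]
    have := innerForm_algebraMap (K := K) 1 1
    simpa using this
  rw [← creation_vacuum, ← creation_vacuum, ← star_annihilation,
    ContinuousLinearMap.star_eq_adjoint, ContinuousLinearMap.adjoint_inner_left, h,
    annihilation_vacuum, map_zero, sub_zero, inner_smul_right, h1, mul_one]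

/-- The inclusion of the one-particle space as an isometry. -/
def oneParticleₗᵢ : K →ₗᵢ[ℂ] FockSpace K :=
  LinearMap.isometryOfInner
    { toFun := oneParticle
      map_add' := fun v w => by
        simp only [oneParticle, map_add, Completion.coe_add]
      map_smul' := fun c v => by
        simp only [oneParticle, map_smul, Completion.coe_smul, RingHom.id_apply] }
    inner_oneParticle

end OneParticle

section Parity

/-- The parity `(-1)^N` on the exterior algebra. -/
def parityₗ : ExteriorAlgebra ℂ K →ₗ[ℂ] ExteriorAlgebra ℂ K :=
  (CliffordAlgebra.involute (Q := (0 : QuadraticForm ℂ K))).toLinearMap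

lemma parityₗ_algebraMap (r : ℂ) :
    parityₗ (algebraMap ℂ (ExteriorAlgebra ℂ K) r) = algebraMap ℂ _ r :=
  AlgHom.commutes _ r

lemma parityₗ_ι_mul (v : K) (x : ExteriorAlgebra ℂ K) :
    parityₗ (ExteriorAlgebra.ι ℂ v * x) = -(ExteriorAlgebra.ι ℂ v * parityₗ x) := by
  refine (map_mul (CliffordAlgebra.involute (Q := (0 : QuadraticForm ℂ K))) _ _).trans ?_
  rw [ExteriorAlgebra.ι, CliffordAlgebra.involute_ι, neg_mul]
  rfl

lemma contract_parityₗ (v : K) (x : ExteriorAlgebra ℂ K) :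
    contract v (parityₗ x) = -parityₗ (contract v x) := by
  induction x using CliffordAlgebra.left_induction with
  | algebraMap r =>
    change contract v (parityₗ (algebraMap ℂ _ r)) = -parityₗ (contract v (algebraMap ℂ _ r))
    rw [parityₗ_algebraMap, contract_algebraMap, map_zero, neg_zero]
  | add a b ha hb =>
    simp only [map_add, ha, hb]
    abel
  | ι_mul x w ih =>
    change contract v (parityₗ (ExteriorAlgebra.ι ℂ w * x))
      = -parityₗ (contract v (ExteriorAlgebra.ι ℂ w * x))
    rw [parityₗ_ι_mul, map_neg, contract_ι_mul, contract_ι_mul, ih, map_sub, parityₗ_ι_mul,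
      map_smul, mul_neg]

lemma inner_parityₗ (x y : ExteriorAlgebra ℂ K) : ⟪parityₗ x, y⟫_ℂ = ⟪x, parityₗ y⟫_ℂ := by
  simp only [inner_eq_innerForm]
  induction y using CliffordAlgebra.left_induction generalizing x with
  | algebraMap r =>
    induction x using CliffordAlgebra.left_induction with
    | algebraMap s =>
      change innerForm (algebraMap ℂ _ r) (parityₗ (algebraMap ℂ _ s))
        = innerForm (parityₗ (algebraMap ℂ _ r)) (algebraMap ℂ _ s)
      rw [parityₗ_algebraMap, parityₗ_algebraMap]
    | add a b ha hb => simp only [map_add, ha, hb]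
    | ι_mul x w ih =>
      change innerForm (algebraMap ℂ _ r) (parityₗ (ExteriorAlgebra.ι ℂ w * x))
        = innerForm (parityₗ (algebraMap ℂ _ r)) (ExteriorAlgebra.ι ℂ w * x)
      rw [parityₗ_algebraMap, innerForm_algebraMap, innerForm_algebraMap, parityₗ_ι_mul, map_neg,
        algebraMapInv_ι_mul, algebraMapInv_ι_mul, neg_zero]
  | add a b ha hb => simp only [map_add, LinearMap.add_apply, ha, hb]
  | ι_mul y w ih =>
    change innerForm (ExteriorAlgebra.ι ℂ w * y) (parityₗ x)
      = innerForm (parityₗ (ExteriorAlgebra.ι ℂ w * y)) x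
    rw [parityₗ_ι_mul, innerForm_ι_mul, map_neg, LinearMap.neg_apply, innerForm_ι_mul, ← ih,
      contract_parityₗ, map_neg]

lemma parityₗ_parityₗ (x : ExteriorAlgebra ℂ K) : parityₗ (parityₗ x) = x :=
  CliffordAlgebra.involute_involute x

lemma norm_parityₗ_le (x : ExteriorAlgebra ℂ K) : ‖parityₗ x‖ ≤ 1 * ‖x‖ := by
  have h : ⟪parityₗ x, parityₗ x⟫_ℂ = ⟪x, x⟫_ℂ := by rw [inner_parityₗ, parityₗ_parityₗ]
  rw [inner_self_eq_norm_sq_to_K, inner_self_eq_norm_sq_to_K] at h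
  have h2 : ‖parityₗ x‖ ^ 2 = ‖x‖ ^ 2 := by exact_mod_cast h
  rw [one_mul, (pow_left_inj₀ (norm_nonneg _) (norm_nonneg _) two_ne_zero).1 h2]

/-- The parity operator `(-1)^N` on the Fock space. -/
def parity : FockSpace K →L[ℂ] FockSpace K := extendCLM (parityₗ.mkContinuous 1 norm_parityₗ_le)

lemma parity_coe (x : ExteriorAlgebra ℂ K) :
    parity (x : FockSpace K) = (parityₗ x : FockSpace K) :=
  extendCLM_coe _ _

lemma star_parity : star (parity (K := K)) = parity := by
  rw [ContinuousLinearMap.star_eq_adjoint, eq_comm, ContinuousLinearMap.eq_adjoint_iff]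
  intro x y
  induction x, y using Completion.induction_on₂ with
  | hp => exact isClosed_eq (by fun_prop) (by fun_prop)
  | ih x y => rw [parity_coe, parity_coe, Completion.inner_coe, Completion.inner_coe, inner_parityₗ]

lemma parity_vacuum : parity (vacuum K) = vacuum K := by
  rw [vacuum, parity_coe]
  congr 1
  simpa using parityₗ_algebraMap (K := K) 1

lemma parity_mul_creation (v : K) : parity * creation v = -(creation v * parity) := by
  refine clm_ext fun x => ?_
  change parity (creation v _) = -(creation v (parity _))
  rw [creation_coe, parity_coe, parity_coe, creation_coe, parityₗ_ι_mul, Completion.coe_neg]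

lemma parity_mul_annihilation (v : K) : parity * annihilation v = -(annihilation v * parity) := by
  have := congrArg star (parity_mul_creation v)
  rw [star_mul, star_neg, star_mul, star_creation, star_parity] at this
  rw [this, neg_neg]

lemma parity_oneParticle (v : K) : parity (oneParticle v) = -oneParticle v := by
  have := congrArg (fun T : FockSpace K →L[ℂ] FockSpace K => T (vacuum K)) (parity_mul_creation v)
  change parity (creation v _) = -(creation v (parity _)) at this
  rwa [parity_vacuum, creation_vacuum] at this

end Parity

section Cyclic

lemma parityₗ_of_mem {n : ℕ} {x : ExteriorAlgebra ℂ K} (hx : x ∈ ⋀[ℂ]^n K) :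
    parityₗ x = (-1 : ℂ) ^ n • x := by
  induction n generalizing x with
  | zero =>
    rw [ExteriorAlgebra.exteriorPower, pow_zero, Submodule.mem_one] at hx
    obtain ⟨r, rfl⟩ := hx
    rw [parityₗ_algebraMap, pow_zero, one_smul]
  | succ n ih =>
    rw [ExteriorAlgebra.exteriorPower, pow_succ'] at hx
    induction hx using Submodule.mul_induction_on' with
    | mem_mul_mem v hv y hy =>
      obtain ⟨v, rfl⟩ := hv
      rw [parityₗ_ι_mul, ih hy, pow_succ', mul_smul_comm, neg_one_mul, neg_smul]
    | add a _ b _ ha hb => rw [map_add, ha, hb, smul_add]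

lemma contract_mem {n : ℕ} {x : ExteriorAlgebra ℂ K} (v : K) (hx : x ∈ ⋀[ℂ]^(n + 1) K) :
    contract v x ∈ ⋀[ℂ]^n K := by
  induction n generalizing x with
  | zero =>
    rw [ExteriorAlgebra.exteriorPower, pow_succ', pow_zero, mul_one] at hx
    obtain ⟨w, rfl⟩ := hx
    have := contract_ι_mul v w 1
    rw [← map_one (algebraMap ℂ (ExteriorAlgebra ℂ K)), contract_algebraMap, map_one, mul_one,
      mul_zero, sub_zero] at this
    rw [this, ExteriorAlgebra.exteriorPower, pow_zero]
    exact Submodule.smul_mem _ _ (Submodule.mem_one.2 ⟨1, map_one _⟩)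
  | succ n ih =>
    rw [ExteriorAlgebra.exteriorPower, pow_succ'] at hx
    induction hx using Submodule.mul_induction_on' with
    | mem_mul_mem w hw y hy =>
      obtain ⟨w, rfl⟩ := hw
      rw [contract_ι_mul]
      refine sub_mem (Submodule.smul_mem _ _ hy) ?_
      rw [ExteriorAlgebra.exteriorPower, pow_succ']
      exact Submodule.mul_mem_mul ⟨w, rfl⟩ (ih hy)
    | add a _ b _ ha hb =>
      rw [map_add]
      exact add_mem ha hb

/-- The vacuum is cyclic for operators `c(v)^* + c(w)` as soon as the vectors `v` are dense: modulo
states with fewer particles, `c(v)^* + c(w)` acts on `n`-particle states as the creation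
operator `c(v)^*`. -/
theorem eq_top_of_creation_add_annihilation_mem {V : Submodule ℂ (FockSpace K)}
    (hV : IsClosed (V : Set (FockSpace K))) (hΩ : vacuum K ∈ V) {D : Set K} (hD : Dense D)
    (h : ∀ v ∈ D, ∃ w, ∀ n, ∀ x ∈ ⋀[ℂ]^n K, (x : FockSpace K) ∈ V →
      creation v (x : FockSpace K) + annihilation w (x : FockSpace K) ∈ V) : V = ⊤ := by
  have key : ∀ n, ∀ x ∈ ⋀[ℂ]^n K, (x : FockSpace K) ∈ V := by
    intro n
    induction n using Nat.strong_induction_on with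
    | _ n ih =>
    intro x hx
    rcases n with _ | n
    · rw [ExteriorAlgebra.exteriorPower, pow_zero, Submodule.mem_one] at hx
      obtain ⟨r, rfl⟩ := hx
      rw [Algebra.algebraMap_eq_smul_one, Completion.coe_smul]
      exact V.smul_mem r hΩ
    · rw [ExteriorAlgebra.exteriorPower, pow_succ'] at hx
      induction hx using Submodule.mul_induction_on' with
      | mem_mul_mem v hv y hy =>
        obtain ⟨v, rfl⟩ := hv
        have hcont : Continuous fun v : K => creation v (y : FockSpace K) := by
          have : (fun v : K => creation v (y : FockSpace K)) = fun v =>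
              ((ExteriorAlgebra.ι ℂ v * y : ExteriorAlgebra ℂ K) : FockSpace K) :=
            funext fun v => creation_coe v y
          rw [this]
          let L : K →ₗ[ℂ] ExteriorAlgebra ℂ K :=
            (LinearMap.mulRight ℂ y).comp (ExteriorAlgebra.ι ℂ)
          have hL : ∀ v, ‖L v‖ ≤ ‖y‖ * ‖v‖ := fun v =>
            (norm_wedgeLeft_le v y).trans_eq (mul_comm _ _)
          exact (Completion.continuous_coe _).comp (L.mkContinuous ‖y‖ hL).continuous
        have hcl : IsClosed {v : K | creation v (y : FockSpace K) ∈ V} := hV.preimage hcont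
        have hsub : D ⊆ {v : K | creation v (y : FockSpace K) ∈ V} := by
          intro v hv
          obtain ⟨w, hw⟩ := h v hv
          have h1 := hw n y hy (ih n (Nat.lt_succ_self n) y hy)
          have h2 : annihilation w (y : FockSpace K) ∈ V := by
            rw [annihilation_coe]
            rcases n with _ | n
            · rw [pow_zero, Submodule.mem_one] at hy
              obtain ⟨r, rfl⟩ := hy
              rw [contract_algebraMap, Completion.coe_zero]
              exact V.zero_mem
            · exact ih n (by omega) _ (contract_mem w hy)
          simpa using V.sub_mem h1 h2
        have := (hcl.closure_subset_iff.2 hsub) (hD v)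
        change creation v (y : FockSpace K) ∈ V at this
        rwa [creation_coe] at this
      | add a _ b _ ha hb =>
        rw [Completion.coe_add]
        exact V.add_mem ha hb
  rw [eq_top_iff]
  rintro x -
  induction x using Completion.induction_on with
  | hp => exact hV
  | ih x =>
    classical
    have hx := DirectSum.sum_support_decompose (fun n => ⋀[ℂ]^n K) x
    rw [← hx]
    have : ∀ s : Finset ℕ, ((∑ i ∈ s, (DirectSum.decompose (fun n => ⋀[ℂ]^n K) x i :
        ExteriorAlgebra ℂ K) : ExteriorAlgebra ℂ K) : FockSpace K) ∈ V := by
      intro s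
      induction s using Finset.cons_induction with
      | empty =>
        rw [Finset.sum_empty, Completion.coe_zero]
        exact V.zero_mem
      | cons i s hi ih =>
        rw [Finset.sum_cons, Completion.coe_add]
        exact V.add_mem (key i _ (Submodule.coe_mem _)) ih
    exact this _

end Cyclic

end Fock

/-! ### The local algebra and its Tomita operator -/

namespace Modular

open ComplexConjugate

variable {E : Type*} [NormedAddCommGroup E] [InnerProductSpace ℂ E] [CompleteSpace E]
  (M : VonNeumannAlgebra E) (Ω : E)

lemma tomita_add_mem {z w : E × E} (hz : z ∈ tomita M Ω) (hw : w ∈ tomita M Ω) :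
    z + w ∈ tomita M Ω := by
  refine map_mem_closure₂ continuous_add hz hw ?_
  rintro _ ⟨A, hA, rfl⟩ _ ⟨B, hB, rfl⟩
  exact ⟨A + B, add_mem hA hB, by rw [star_add]; rfl⟩

lemma tomita_smul_mem (c : ℂ) {x y : E} (h : (x, y) ∈ tomita M Ω) :
    (c • x, conj c • y) ∈ tomita M Ω := by
  refine map_mem_closure (f := fun z : E × E => (c • z.1, conj c • z.2)) (by fun_prop) h ?_
  rintro _ ⟨A, hA, rfl⟩
  exact ⟨c • A, M.toSubalgebra.smul_mem hA c, by rw [star_smul]; rfl⟩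

lemma tomita_symm {x y : E} (h : (x, y) ∈ tomita M Ω) : (y, x) ∈ tomita M Ω := by
  refine map_mem_closure (f := Prod.swap) continuous_swap h ?_
  rintro _ ⟨A, hA, rfl⟩
  exact ⟨star A, star_mem hA, by rw [star_star]; rfl⟩

end Modular

namespace CAR

open Modular Fock ComplexConjugate
open UniformSpace (Completion)

variable {H : Type*} [NormedAddCommGroup H] [InnerProductSpace ℂ H]
  {Γ : H ≃ₗᵢ⋆[ℂ] H} (hΓ : ∀ x, Γ (Γ x) = x) {p : Submodule ℂ H} [p.HasOrthogonalProjection]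

section Generators

lemma generator_vacuum (f : H) :
    generator Γ p f (vacuum p) = oneParticle (p.orthogonalProjectionOnto (Γ f)) := by
  change creation _ (vacuum p) + annihilation _ (vacuum p) = _
  rw [creation_vacuum, annihilation_vacuum, add_zero]

lemma parity_mul_generator (f : H) :
    parity * generator Γ p f = -(generator Γ p f * parity) := by
  rw [generator, mul_add, parity_mul_creation, parity_mul_annihilation, add_mul, neg_add]

/-- The canonical anticommutation relations. -/
lemma creation_add_annihilation_mul {K : Type*} [NormedAddCommGroup K] [InnerProductSpace ℂ K]
    (u v u' v' : K) :
    (creation u + annihilation v) * (creation u' + annihilation v')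
      = (⟪v, u'⟫_ℂ + ⟪v', u⟫_ℂ) • 1
        - (creation u' + annihilation v') * (creation u + annihilation v) := by
  have h1 := creation_mul_creation u u'
  have h2 := annihilation_mul_annihilation v v'
  have h3 := annihilation_mul_creation v u'
  have h4 := annihilation_mul_creation v' u
  generalize creation u = C at *
  generalize creation u' = C' at *
  generalize annihilation v = A at *
  generalize annihilation v' = A' at *
  rw [add_mul, mul_add, mul_add, add_mul, mul_add, mul_add, add_smul, h1, h2, h3, h4]
  abel

include hΓ in
lemma generator_mul_generator (hp : IsBasisProjection Γ p) (f g : H) :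
    generator Γ p f * generator Γ p g = ⟪f, Γ g⟫_ℂ • 1 - generator Γ p g * generator Γ p f := by
  have h := inner_projection_conjugation_eq hΓ hp (Γ g) (Γ f)
  rw [hΓ, hΓ] at h
  rw [generator, generator, creation_add_annihilation_mul, h, sub_add_cancel]

/-- The operator `a(f) (-1)^N`, which commutes with `a(g)` if `f` is orthogonal to `Γ g`. -/
def twistedGenerator (Γ : H ≃ₗᵢ⋆[ℂ] H) (p : Submodule ℂ H) [p.HasOrthogonalProjection] (f : H) :
    FockSpace p →L[ℂ] FockSpace p :=
  generator Γ p f * parity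

lemma twistedGenerator_vacuum (f : H) :
    twistedGenerator Γ p f (vacuum p) = oneParticle (p.orthogonalProjectionOnto (Γ f)) := by
  change generator Γ p f (parity (vacuum p)) = _
  rw [parity_vacuum, generator_vacuum]

include hΓ in
lemma star_twistedGenerator_vacuum (f : H) :
    star (twistedGenerator Γ p f) (vacuum p) = -oneParticle (p.orthogonalProjectionOnto f) := by
  rw [twistedGenerator, star_mul, star_parity, star_generator hΓ]
  change parity (generator Γ p (Γ f) (vacuum p)) = _
  rw [generator_vacuum, parity_oneParticle, hΓ]

end Generators

section LocalAlgebra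

variable {q : Submodule ℂ H} (hq : ∀ x ∈ q, Γ x ∈ q)

lemma generator_mem_localAlgebra {f : H} (hf : f ∈ q) :
    generator Γ p f ∈ localAlgebra hΓ p hq := by
  change generator Γ p f ∈ Set.centralizer (Set.centralizer (generator Γ p '' q))
  exact Set.subset_centralizer_centralizer ⟨f, hf, rfl⟩

include hΓ hq in
/-- Twisted locality: the twisted generators of the orthogonal complement lie in the
commutant. -/
lemma twistedGenerator_mem_centralizer (hp : IsBasisProjection Γ p) {f : H} (hf : f ∈ qᗮ) :
    twistedGenerator Γ p f ∈ Set.centralizer (generator Γ p '' q) := by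
  rintro _ ⟨g, hg, rfl⟩
  have h : ⟪f, Γ g⟫_ℂ = 0 := (Submodule.mem_orthogonal' _ _).1 hf _ (hq g hg)
  have h1 := generator_mul_generator hΓ hp f g
  rw [h, zero_smul, zero_sub] at h1
  rw [twistedGenerator, mul_assoc, parity_mul_generator, mul_neg, ← mul_assoc, ← mul_assoc, h1,
    neg_mul, neg_neg]

lemma mul_comm_of_mem_centralizer {A B : FockSpace p →L[ℂ] FockSpace p}
    (hA : A ∈ localAlgebra hΓ p hq) (hB : B ∈ Set.centralizer (generator Γ p '' q)) :
    A * B = B * A :=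
  (hA B hB).symm

lemma inner_star_vacuum {A B : FockSpace p →L[ℂ] FockSpace p}
    (hA : A ∈ localAlgebra hΓ p hq) (hB : B ∈ Set.centralizer (generator Γ p '' q)) :
    ⟪star A (vacuum p), B (vacuum p)⟫_ℂ = ⟪star B (vacuum p), A (vacuum p)⟫_ℂ := by
  rw [ContinuousLinearMap.star_eq_adjoint, ContinuousLinearMap.star_eq_adjoint,
    ContinuousLinearMap.adjoint_inner_left, ContinuousLinearMap.adjoint_inner_left]
  exact congrArg (fun T : FockSpace p →L[ℂ] FockSpace p => ⟪vacuum p, T (vacuum p)⟫_ℂ)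
    (mul_comm_of_mem_centralizer hΓ hq hA hB)

include hΓ hq in
lemma dense_projection_conjugation [CompleteSpace p] (hpq' : p ⊓ qᗮ = ⊥) :
    Dense ((fun f => p.orthogonalProjectionOnto (Γ f)) '' q) := by
  refine (dense_projection hpq').mono ?_
  rintro _ ⟨f, hf, rfl⟩
  exact ⟨Γ f, hq f hf, by simp only [hΓ]⟩

omit [p.HasOrthogonalProjection] in
/-- A criterion for the vacuum to be cyclic for a subalgebra. -/
lemma dense_vacuum_orbit (N : Subalgebra ℂ (FockSpace p →L[ℂ] FockSpace p)) {D : Set p}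
    (hD : Dense D)
    (h : ∀ v ∈ D, ∃ w, ∀ n, ∃ B ∈ N, ∀ x ∈ ⋀[ℂ]^n p,
      creation v (x : FockSpace p) + annihilation w (x : FockSpace p) = B (x : FockSpace p)) :
    Dense {x | ∃ A ∈ N, x = A (vacuum p)} := by
  let L : (FockSpace p →L[ℂ] FockSpace p) →ₗ[ℂ] FockSpace p :=
    { toFun := fun A => A (vacuum p)
      map_add' := fun _ _ => rfl
      map_smul' := fun _ _ => rfl }
  let V : Submodule ℂ (FockSpace p) := (Subalgebra.toSubmodule N).map L
  have hV : V.topologicalClosure = ⊤ := by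
    refine eq_top_of_creation_add_annihilation_mem V.isClosed_topologicalClosure
      (V.le_topologicalClosure ⟨1, N.one_mem, rfl⟩) hD fun v hv => ?_
    obtain ⟨w, hw⟩ := h v hv
    refine ⟨w, fun n x hx hxV => ?_⟩
    obtain ⟨B, hB, hBx⟩ := hw n
    rw [hBx x hx]
    refine map_mem_closure B.continuous hxV ?_
    rintro _ ⟨A, hA, rfl⟩
    exact ⟨B * A, N.mul_mem hB hA, rfl⟩
  refine (Submodule.dense_iff_topologicalClosure_eq_top.2 hV).mono ?_
  rintro _ ⟨A, hA, rfl⟩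
  exact ⟨A, hA, rfl⟩

variable [CompleteSpace p]

lemma dense_localAlgebra_vacuum (hpq' : p ⊓ qᗮ = ⊥) :
    Dense {x | ∃ A ∈ localAlgebra hΓ p hq, x = A (vacuum p)} := by
  refine dense_vacuum_orbit (localAlgebra hΓ p hq).toSubalgebra
    (dense_projection_conjugation hΓ hq hpq') ?_
  rintro _ ⟨f, hf, rfl⟩
  exact ⟨p.orthogonalProjectionOnto f, fun n =>
    ⟨generator Γ p f, generator_mem_localAlgebra hΓ hq hf, fun x hx => rfl⟩⟩

include hΓ hq in
/-- The vacuum is cyclic for the commutant: up to a sign, a twisted generator acts on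
`n`-particle states as the generator does. -/
lemma dense_centralizer_vacuum (hp : IsBasisProjection Γ p) [q.HasOrthogonalProjection]
    (hpq : p ⊓ q = ⊥) :
    Dense {x | ∃ B ∈ Set.centralizer (generator Γ p '' q), x = B (vacuum p)} := by
  refine dense_vacuum_orbit (Subalgebra.centralizer ℂ (generator Γ p '' q))
    (dense_projection_conjugation (q := qᗮ) hΓ
      (fun x hx => conjugation_mem_orthogonal hΓ hq hx) (by
        rwa [Submodule.orthogonal_orthogonal])) ?_
  rintro _ ⟨f, hf, rfl⟩
  refine ⟨p.orthogonalProjectionOnto f, fun n => ⟨(-1 : ℂ) ^ n • twistedGenerator Γ p f,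
    Subalgebra.smul_mem _ (twistedGenerator_mem_centralizer hΓ hq hp hf) _, fun x hx => ?_⟩⟩
  change _ = (-1 : ℂ) ^ n • generator Γ p f (parity (x : FockSpace p))
  rw [parity_coe, parityₗ_of_mem hx, Completion.coe_smul, map_smul, smul_smul, ← mul_pow]
  simp only [mul_neg, mul_one, neg_neg, one_pow, one_smul]
  rfl

end LocalAlgebra

section Tomita

variable {q : Submodule ℂ H} (hq : ∀ x ∈ q, Γ x ∈ q)

/-- The Tomita operator is contained in the adjoint of `B Ω ↦ B^* Ω`, for `B` in the commutant. -/
lemma inner_of_mem_tomita {x y : FockSpace p}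
    (h : (x, y) ∈ tomita (localAlgebra hΓ p hq) (vacuum p)) {B : FockSpace p →L[ℂ] FockSpace p}
    (hB : B ∈ Set.centralizer (generator Γ p '' q)) :
    ⟪y, B (vacuum p)⟫_ℂ = ⟪star B (vacuum p), x⟫_ℂ := by
  have hcl : IsClosed {z : FockSpace p × FockSpace p |
      ⟪z.2, B (vacuum p)⟫_ℂ = ⟪star B (vacuum p), z.1⟫_ℂ} :=
    isClosed_eq (by fun_prop) (by fun_prop)
  refine closure_minimal ?_ hcl h
  rintro _ ⟨A, hA, rfl⟩
  exact inner_star_vacuum hΓ hq hA hB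

variable [CompleteSpace p]

/-- The Tomita operator is single-valued and densely defined, since the vacuum is cyclic for the
algebra and for its commutant. -/
lemma isAntilinearInvolution_tomita (hp : IsBasisProjection Γ p) [q.HasOrthogonalProjection]
    (hpq : p ⊓ q = ⊥) (hpq' : p ⊓ qᗮ = ⊥) :
    IsAntilinearInvolution (tomita (localAlgebra hΓ p hq) (vacuum p)) where
  isClosed := isClosed_closure
  add_mem := tomita_add_mem _ _
  smul_mem := tomita_smul_mem _ _
  dense := (dense_localAlgebra_vacuum hΓ hq hpq').mono (by
    rintro _ ⟨A, hA, rfl⟩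
    exact ⟨star A (vacuum p), subset_closure ⟨A, hA, rfl⟩⟩)
  eq_zero := by
    intro y h
    refine (dense_centralizer_vacuum hΓ hq hp hpq).eq_zero_of_inner_left ℂ ?_
    rintro _ ⟨B, hB, rfl⟩
    rw [inner_of_mem_tomita hΓ hq h hB, inner_zero_right]
  symm := tomita_symm _ _

omit [CompleteSpace p] in
lemma oneParticle_mem_tomita {u w : p} (h : (u, w) ∈ beta Γ p q) :
    (oneParticle u, oneParticle w) ∈ tomita (localAlgebra hΓ p hq) (vacuum p) := by
  obtain ⟨x, hx, h⟩ := h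
  obtain ⟨rfl, rfl⟩ := Prod.ext_iff.1 h
  refine subset_closure
    ⟨generator Γ p (Γ x), generator_mem_localAlgebra hΓ hq (hq x hx), ?_⟩
  rw [star_generator hΓ, generator_vacuum, generator_vacuum, hΓ]

/-- The one-particle space reduces the Tomita operator to `β`: the component of `S x` in the
one-particle space is the image under `α^* = β` of the component of `x`, since `S` is contained
in the adjoint of an operator extending `α`. -/
lemma adjoint_oneParticle_mem_beta (hp : IsBasisProjection Γ p) [q.HasOrthogonalProjection]
    {x y : FockSpace p} (h : (x, y) ∈ tomita (localAlgebra hΓ p hq) (vacuum p)) :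
    ((oneParticleₗᵢ (K := p)).toContinuousLinearMap.adjoint x,
      (oneParticleₗᵢ (K := p)).toContinuousLinearMap.adjoint y) ∈ beta Γ p q := by
  rw [← antilinearAdjoint_alpha hΓ hp hq]
  rintro _ _ ⟨f, hf, hf'⟩
  obtain ⟨rfl, rfl⟩ := Prod.ext_iff.1 hf'
  simp only
  rw [ContinuousLinearMap.adjoint_inner_left, ContinuousLinearMap.adjoint_inner_right]
  have h1 := inner_of_mem_tomita hΓ hq h
    (twistedGenerator_mem_centralizer hΓ hq hp (conjugation_mem_orthogonal hΓ hq hf))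
  rw [twistedGenerator_vacuum, star_twistedGenerator_vacuum hΓ, hΓ] at h1
  refine h1.trans (congrArg (fun v => ⟪v, x⟫_ℂ) ?_)
  exact (map_neg oneParticleₗᵢ _).symm

/-- The one-particle space reduces the resolvent of the Tomita operator. -/
lemma resolvent_oneParticle (hp : IsBasisProjection Γ p) [q.HasOrthogonalProjection]
    (hpq : p ⊓ q = ⊥) (hpq' : p ⊓ qᗮ = ⊥) {A : FockSpace p →L[ℂ] FockSpace p}
    (hA : IsResolvent (tomita (localAlgebra hΓ p hq) (vacuum p)) A) (z : p) :
    A (oneParticleₗᵢ z) = oneParticleₗᵢ (compression p q z) := by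
  obtain ⟨y, hy, h⟩ := isResolvent_beta (q := q) hΓ hp z
  refine hA.apply_eq (isAntilinearInvolution_tomita hΓ hq hp hpq hpq')
    (oneParticle_mem_tomita hΓ hq hy) fun u v huv => ?_
  have := h _ _ (adjoint_oneParticle_mem_beta hΓ hq hp huv)
  rw [ContinuousLinearMap.adjoint_inner_left, ContinuousLinearMap.adjoint_inner_right, map_sub]
    at this
  exact this

end Tomita

end CAR

end

theorem mainTheorem3 {H : Type*} [NormedAddCommGroup H] [InnerProductSpace ℂ H] [CompleteSpace H]
    (Γ : H ≃ₗᵢ⋆[ℂ] H) (hΓ : ∀ x, Γ (Γ x) = x)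
    (p q : Submodule ℂ H) [CompleteSpace p] [CompleteSpace q]
    (hp : CAR.IsBasisProjection Γ p) (hq : ∀ x ∈ q, Γ x ∈ q)
    (hpq : p ⊓ q = ⊥) (hpq' : p ⊓ qᗮ = ⊥) :
    ∃ Δp : p →ₗ.[ℂ] p,
      Modular.graphRel Δp
          = Modular.opMul (Modular.antilinearAdjoint (CAR.beta Γ p q)) (CAR.beta Γ p q) ∧
      Modular.IsPositiveSelfAdjoint Δp ∧
      Modular.graphRel Δp
          = {z : p × p | ∃ x : p,
              z = (p.orthogonalProjectionOnto (q.starProjection x),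
                p.orthogonalProjectionOnto (qᗮ.starProjection x))} ∧
      LinearMap.ker Δp.toFun = ⊥ ∧
      Modular.graphRel Δp.inverse
          = Modular.opMul (CAR.beta Γ p q) (Modular.antilinearAdjoint (CAR.beta Γ p q)) ∧
      Modular.graphRel Δp.inverse
          = Modular.opMul (Modular.antilinearAdjoint (CAR.alpha Γ p q)) (CAR.alpha Γ p q) ∧
      ∃ (R : p →ₗ.[ℂ] p) (Δ : Fock.FockSpace p →ₗ.[ℂ] Fock.FockSpace p)
          (J : Fock.FockSpace p ≃ₗᵢ⋆[ℂ] Fock.FockSpace p),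
        Modular.IsPositiveSqrt Δp R ∧
        (∀ R', Modular.IsPositiveSqrt Δp R' → R' = R) ∧
        Modular.IsModularPair (CAR.localAlgebra hΓ p hq) (Fock.vacuum p) Δ J ∧
        (∀ Δ' J', Modular.IsModularPair (CAR.localAlgebra hΓ p hq) (Fock.vacuum p) Δ' J' →
          Δ' = Δ ∧ J' = J) ∧
        ∀ x ∈ q, ∃ h : p.orthogonalProjectionOnto (Γ x) ∈ R.domain,
          J (Fock.oneParticle (p.orthogonalProjectionOnto x))
            = Fock.oneParticle (R ⟨p.orthogonalProjectionOnto (Γ x), h⟩) := by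
  have hβ := CAR.isAntilinearInvolution_beta hΓ hp hq hpq hpq'
  have hA := CAR.isResolvent_beta (q := q) hΓ hp
  have hAc := hA.isContractiveResolvent hβ
  have hq' : ∀ x ∈ qᗮ, Γ x ∈ qᗮ := fun x hx => CAR.conjugation_mem_orthogonal hΓ hq hx
  have hβ' := CAR.isAntilinearInvolution_beta (q := qᗮ) hΓ hp hq' hpq' (by
    rwa [Submodule.orthogonal_orthogonal])
  have hα := hβ'.negRel
  have hA' := (CAR.isResolvent_beta (q := qᗮ) hΓ hp).negRel
  rw [CAR.beta_orthogonal_eq] at hα hA'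
  have hker : LinearMap.ker (Modular.ofResolvent (CAR.compression p q)).toFun = ⊥ := by
    rw [LinearMap.ker_eq_bot']
    intro x hx
    obtain ⟨z, h1, h2⟩ := hAc.mem_graph_ofResolvent.1
      ((Modular.ofResolvent (CAR.compression p q)).mem_graph x)
    have h3 : z - CAR.compression p q z = 0 := h2.trans hx
    rw [CAR.sub_compression_apply] at h3
    have h4 : z = 0 := (injective_iff_map_eq_zero _).1
      (hA'.isContractiveResolvent hα).injective z h3
    refine Subtype.ext ?_
    rw [ZeroMemClass.coe_zero]
    simp only at h1
    rw [← h1, h4, map_zero]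
  have hinv : Modular.graphRel (Modular.ofResolvent (CAR.compression p q)).inverse
      = Modular.opMul (Modular.antilinearAdjoint (CAR.alpha Γ p q)) (CAR.alpha Γ p q) := by
    ext ⟨x, w⟩
    rw [hA'.mem_opMul_adjoint hα, Modular.mem_graphRel, LinearPMap.inverse_graph hker]
    constructor
    · rintro ⟨⟨a, b⟩, hab, h⟩
      obtain ⟨rfl, rfl⟩ := Prod.ext_iff.1 h
      obtain ⟨z, h1, h2⟩ := hAc.mem_graph_ofResolvent.1 hab
      refine ⟨z, ?_, ?_⟩
      · rw [← CAR.sub_compression_apply]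
        exact h2
      · rw [← CAR.sub_compression_apply, sub_sub_cancel]
        exact h1
    · rintro ⟨z, rfl, rfl⟩
      refine ⟨(z - CAR.compression p qᗮ z, CAR.compression p qᗮ z),
        hAc.mem_graph_ofResolvent.2 ⟨z, ?_, ?_⟩, rfl⟩ <;> simp only
      · rw [← CAR.sub_compression_apply, sub_sub_cancel]
      · rw [CAR.sub_compression_apply]
  have hS := CAR.isAntilinearInvolution_tomita hΓ hq hp hpq hpq'
  obtain ⟨B, hB⟩ := hS.exists_isResolvent
  have hBc := hB.isContractiveResolvent hS
  obtain ⟨J, hJJ, hJ⟩ := hB.exists_polar hS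
  obtain ⟨j, -, hj⟩ := hA.exists_polar hβ
  refine ⟨Modular.ofResolvent (CAR.compression p q), ?_, hAc.isPositiveSelfAdjoint, ?_, hker, ?_,
    hinv, Modular.sqrtOfResolvent (CAR.compression p q), Modular.ofResolvent B, J,
    hAc.isPositiveSqrt, fun R' hR' => hAc.eq_sqrtOfResolvent hR',
    ⟨hBc.isPositiveSelfAdjoint, _, hBc.isPositiveSqrt, hJ⟩, ?_, ?_⟩
  · ext ⟨x, w⟩
    rw [hA.mem_opMul_adjoint hβ]
    exact hAc.mem_graph_ofResolvent
  · ext ⟨x, w⟩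
    refine hAc.mem_graph_ofResolvent.trans (exists_congr fun z => ?_)
    rw [CAR.sub_compression_apply, Prod.mk_inj, eq_comm, CAR.compression_apply,
      eq_comm (b := w), CAR.compression_apply]
  · rw [hinv, CAR.antilinearAdjoint_alpha hΓ hp hq, CAR.antilinearAdjoint_beta hΓ hp hq]
  · rintro Δ' J' ⟨-, R', hR', hJ'⟩
    have hΔ := hB.eq_ofResolvent hS hR' hJ'
    rw [hΔ] at hR'
    obtain rfl := hBc.eq_sqrtOfResolvent hR'
    refine ⟨hΔ, ?_⟩
    -- `J` and `J'` agree on the range of `Δ^{1/2}`, whose image under `J` is the range of `S`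
    have hagree : ∀ u v, (u, v) ∈ Modular.tomita (CAR.localAlgebra hΓ p hq) (Fock.vacuum p) →
        J' (J.symm v) = v := by
      intro u v huv
      have huv' := huv
      rw [hJ] at huv
      obtain ⟨a, ha⟩ := huv
      obtain ⟨rfl, rfl⟩ := Prod.ext_iff.1 ha
      have ha' : ((a : Fock.FockSpace p), J' (Modular.sqrtOfResolvent B a))
          ∈ Modular.tomita (CAR.localAlgebra hΓ p hq) (Fock.vacuum p) := by
        rw [hJ']
        exact ⟨a, rfl⟩
      rw [J.symm_apply_apply]
      exact hS.unique ha' huv'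
    have hall : ∀ v, J' (J.symm v) = v := fun v =>
      congrFun (Continuous.ext_on hS.dense (J'.continuous.comp J.symm.continuous) continuous_id
        fun v ⟨u, hvu⟩ => hagree u v (hS.symm hvu)) v
    refine LinearIsometryEquiv.ext fun w => ?_
    rw [← hall (J w), J.symm_apply_apply]
  · intro x hx
    have h1 : (p.orthogonalProjectionOnto (Γ x), p.orthogonalProjectionOnto x)
        ∈ CAR.beta Γ p q := ⟨Γ x, hq x hx, by rw [hΓ]⟩
    have h2 := h1
    rw [hj] at h2
    obtain ⟨u, hu⟩ := h2
    obtain ⟨hu1, -⟩ := Prod.ext_iff.1 hu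
    simp only at hu1
    have hdom : p.orthogonalProjectionOnto (Γ x)
        ∈ (Modular.sqrtOfResolvent (CAR.compression p q)).domain := hu1 ▸ u.2
    refine ⟨hdom, ?_⟩
    have h3 := CAR.oneParticle_mem_tomita hΓ hq h1
    rw [hJ] at h3
    obtain ⟨v, hv⟩ := h3
    obtain ⟨hv1, hv2⟩ := Prod.ext_iff.1 hv
    simp only at hv1 hv2
    -- `P x = S (P Γ x) = J Δ^{1/2} (P Γ x)`, and `Δ^{1/2}` restricts to `R` on `p`.
    have h4 := Modular.map_mem_graph_sqrtOfResolvent Fock.oneParticleₗᵢ hBc hAc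
      (CAR.resolvent_oneParticle hΓ hq hp hpq hpq' hB)
      ((Modular.sqrtOfResolvent (CAR.compression p q)).mem_graph ⟨_, hdom⟩)
    rw [hv2, hJJ]
    exact (Modular.sqrtOfResolvent B).mem_graph_snd_inj
      ((Modular.sqrtOfResolvent B).mem_graph v) h4 hv1.symm
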